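/- Let $N = 2n$ with $n \ge 1$ an integer, let $Z > 0$, and let $\Omega_{nuc} \subset \mathbb{R}^3$ be compact. Let $e_{xc} : [0,\infty) \to \mathbb{R}$ be continuously differentiable with derivative $v_{xc} = e_{xc}'$ (one-sided at $0$), and assume that $e_{xc}(0) = v_{xc}(0) = 0$, that $v_{xc} \le 0$, that $|v_{xc}(\rho)| \le c_{xc}(1 + \rho^{p-1})$ for all $\rho \ge 0$, for some $p \in [1, \tfrac53)$ and $c_{xc} > 0$, and that $\limsup_{\rho \to 0+} e_{xc}(\rho)/\rho^{q} < 0$ for some $q \in [1, \tfrac32)$. Let $\mu$ be a nonnegative Radon measure carried by $\Omega_{nuc}$ with total mass $Z$, and let $\Phi = (\varphi_1, \dots, \varphi_n) \in H^1(\mathbb{R}^3;\mathbb{C})^n$ be $L^2$-orthonormal. Put $\rho = 2\sum_{k=1}^n |\varphi_k|^2$, $v_{ext}(x) = -\int |x-y|^{-1}\,d\mu(y)$, $v_H(x) = \int_{\mathbb{R}^3} \rho(y)|x-y|^{-1}\,dy$, and, for $\chi \in H^1(\mathbb{R}^3;\mathbb{C})$, $$\mathcal{E}_{\mu,\rho}[\chi]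 = \tfrac12 \int_{\mathbb{R}^3} |\nabla \chi|^2 + \int_{\mathbb{R}^3} \big(v_{ext} + v_H + v_{xc}(\rho)\big)|\chi|^2 .$$ Then $\mathcal{E}_{\mu,\rho}$ has a maximizer on $\{\chi \in \mathrm{Span}_{\mathbb{C}}\{\varphi_1,\dots,\varphi_n\} : \|\chi\|_{L^2} = 1\}$ (a HOMO). If, in addition, $Z > N$ and there is $\gamma > 0$ such that $e^{\gamma|\cdot|}\varphi_j \in H^1(\mathbb{R}^3)$ for all $j \in \{1,\dots,n\}$, then $\mathcal{E}_{\mu,\rho}$ also has a minimizer on $\{\chi \in H^1(\mathbb{R}^3;\mathbb{C}) : \langle \varphi_k, \chi\rangle_{L^2} = 0 \text{ for } k = 1,\dots,n,\ \|\chi\|_{L^2} = 1\}$ (a LUMO). -/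

import Mathlib

open MeasureTheory Filter Topology Set
open scoped ENNReal SchwartzMap LineDeriv

noncomputable section

namespace KohnSham

/-- Euclidean space `ℝ³`. -/
abbrev E3 : Type := EuclideanSpace ℝ (Fin 3)

/-- The complex Hilbert space `L²(ℝ³; ℂ)`. -/
abbrev L2 : Type := Lp ℂ 2 (volume : Measure E3)

/-- The Sobolev space `H¹(ℝ³)`, as a subspace of `L²(ℝ³)`. -/
def H1 : Submodule ℂ L2 where
  carrier := {u | TemperedDistribution.MemSobolev 1 2 (u : 𝓢'(E3, ℂ))}
  add_mem' {u v} hu hv := by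
    have h := TemperedDistribution.MemSobolev.add hu hv
    have e := (Lp.toTemperedDistributionCLM ℂ (volume : Measure E3) 2).map_add u v
    simp only [Lp.toTemperedDistributionCLM_apply] at e
    simpa only [mem_ofPred_eq, e] using h
  zero_mem' := by
    have e := (Lp.toTemperedDistributionCLM ℂ (volume : Measure E3) 2).map_zero
    simp only [Lp.toTemperedDistributionCLM_apply] at e
    simpa only [mem_ofPred_eq, e] using TemperedDistribution.memSobolev_fun_zero E3 ℂ 1 2
  smul_mem' c u hu := by
    have h := TemperedDistribution.MemSobolev.smul c hu
    have e := (Lp.toTemperedDistributionCLM ℂ (volume : Measure E3) 2).map_smul c u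
    simp only [Lp.toTemperedDistributionCLM_apply] at e
    simpa only [mem_ofPred_eq, e] using h

/-- `g ∈ L²(ℝ³)` is the `i`-th weak partial derivative of `u ∈ L²(ℝ³)`: the distributional
derivative of `u` in the `i`-th coordinate direction is (the distribution given by) `g`. -/
def IsWeakPartial (i : Fin 3) (u g : L2) : Prop :=
  ∂_{(EuclideanSpace.single i (1 : ℝ) : E3)} (u : 𝓢'(E3, ℂ)) = (g : 𝓢'(E3, ℂ))

theorem exists_isWeakPartial (i : Fin 3) {u : L2} (hu : u ∈ H1) : ∃ g, IsWeakPartial i u g := by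
  have h := TemperedDistribution.MemSobolev.lineDerivOp
    (m := (EuclideanSpace.single i (1 : ℝ) : E3)) hu
  rw [sub_self, TemperedDistribution.memSobolev_zero_iff] at h
  exact h

theorem IsWeakPartial.unique {i : Fin 3} {u g g' : L2} (h : IsWeakPartial i u g)
    (h' : IsWeakPartial i u g') : g = g' := by
  have k := LinearMap.ker_eq_bot.1
    (Lp.ker_toTemperedDistributionCLM_eq_bot (F := ℂ) (μ := (volume : Measure E3)) (p := 2))
  exact k (h.symm.trans h')

open Classical in
/-- The `i`-th weak partial derivative `∂ᵢ u ∈ L²(ℝ³)`; it is used only for `u ∈ H¹(ℝ³)`, where it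
exists and is unique. -/
def weakPartial (i : Fin 3) (u : L2) : L2 :=
  if h : ∃ g, IsWeakPartial i u g then h.choose else 0

theorem isWeakPartial_weakPartial (i : Fin 3) {u : L2} (hu : u ∈ H1) :
    IsWeakPartial i u (weakPartial i u) := by
  rw [weakPartial, dif_pos (exists_isWeakPartial i hu)]
  exact (exists_isWeakPartial i hu).choose_spec

/-- The exchange-correlation potential `v_xc = d e_xc / dρ` on `[0, ∞)` (one-sided at `0`). -/
def vxc (exc : ℝ → ℝ) (ρ : ℝ) : ℝ := derivWithin exc (Ici 0) ρ

/-- The assumptions on the exchange-correlation energy density `e_xc : [0, ∞) → ℝ`. Only the values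
of `exc` on `[0, ∞)` matter. -/
structure AdmissibleXC (exc : ℝ → ℝ) : Prop where
  contDiffOn : ContDiffOn ℝ 1 exc (Ici 0)
  exc_zero : exc 0 = 0
  vxc_zero : vxc exc 0 = 0
  vxc_nonpos : ∀ ρ, 0 ≤ ρ → vxc exc ρ ≤ 0
  growth : ∃ p : ℝ, 1 ≤ p ∧ p < 5 / 3 ∧ ∃ c : ℝ, 0 < c ∧
    ∀ ρ, 0 ≤ ρ → |vxc exc ρ| ≤ c * (1 + ρ ^ (p - 1))
  near_zero : ∃ q : ℝ, 1 ≤ q ∧ q < 3 / 2 ∧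
    limsup (fun ρ : ℝ => ((exc ρ / ρ ^ q : ℝ) : EReal)) (𝓝[>] 0) < 0

/-- The admissible nuclear charge distributions: nonnegative (Radon) measures carried by `Ω`, of
total mass `Z`. -/
def Anuc (Ω : Set E3) (Z : ℝ) : Set (Measure E3) :=
  {μ | μ Ωᶜ = 0 ∧ μ univ = ENNReal.ofReal Z}

variable {n : ℕ}

/-- The admissible orbitals: `L²`-orthonormal `n`-tuples in `H¹(ℝ³)`. -/
def orbitalSet (n : ℕ) : Set (Fin n → L2) :=
  {Φ | (∀ k, Φ k ∈ H1) ∧ Orthonormal ℂ Φ}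

/-- The electron density `ρ = 2 ∑ₖ |φₖ|²`. -/
def density (Φ : Fin n → L2) (x : E3) : ℝ := 2 * ∑ k, ‖Φ k x‖ ^ 2

/-- The nuclear potential `v_ext(x) = -∫ |x - y|⁻¹ dμ(y)`. -/
def vext (μ : Measure E3) (x : E3) : ℝ := -∫ y, 1 / ‖x - y‖ ∂μ

/-- The Hartree potential `v_H(x) = ∫ ρ(y) |x - y|⁻¹ dy`. -/
def vHartree (ρ : E3 → ℝ) (x : E3) : ℝ := ∫ y, ρ y / ‖x - y‖

/-- The excitation energy functional
`χ ↦ ⟨χ, h_{μ,ρ} χ⟩ = ½ ∫ |∇χ|² + ∫ (v_ext + v_H + v_xc(ρ)) |χ|²` on `H¹(ℝ³)`. -/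
def excitationEnergy (exc : ℝ → ℝ) (μ : Measure E3) (ρ : E3 → ℝ) (χ : L2) : ℝ :=
  1 / 2 * (∫ x, ∑ i, ‖weakPartial i χ x‖ ^ 2) +
    ∫ x, (vext μ x + vHartree ρ x + vxc exc (ρ x)) * ‖χ x‖ ^ 2

/-- The unit vectors in the span of the orbitals. -/
def homoSet (Φ : Fin n → L2) : Set L2 :=
  {χ | χ ∈ Submodule.span ℂ (range Φ) ∧ ‖χ‖ = 1}

/-- The `L²`-unit vectors in `H¹(ℝ³)` that are orthogonal to the orbitals. -/
def lumoSet (Φ : Fin n → L2) : Set L2 :=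
  {χ | χ ∈ H1 ∧ (∀ k, inner ℂ (Φ k) χ = 0) ∧ ‖χ‖ = 1}

/-- Exponential decay: for some `γ > 0`, `e^{γ|x|} φⱼ ∈ H¹(ℝ³)` for all `j`. -/
def ExpDecay (Φ : Fin n → L2) : Prop :=
  ∃ γ : ℝ, 0 < γ ∧ ∀ j, ∃ u ∈ H1,
    (u : E3 → ℂ) =ᵐ[volume] fun x => (Real.exp (γ * ‖x‖) : ℂ) * Φ j x

end KohnSham

end

/-!
The Bessel potential `f ↦ (1 - (2π)⁻² Δ)^(-1/2) f` maps `L²` isometrically onto `H¹` with the norm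
in which `½ ∫ |∇u|²` is `2π² (‖f‖² - ‖u‖²)`; so bounded energy gives a bound on `f`, and the kinetic
energy is weakly lower semicontinuous in `f`. The Coulomb and exchange-correlation potentials lie in
`L³ᐟ² + (L^∞)_ε`, so that their quadratic forms are weakly continuous: outside a set of finite
measure they are small, and on that set Rellich's theorem and the Sobolev inequality apply.

The energy is therefore continuous on the unit sphere of a finite-dimensional subspace of `H¹`, and
has a maximum there. For the minimum it suffices that the infimum `m` be negative: the weak limit
`χ` of a minimizing sequence then satisfies `m ‖χ‖² ≤ energy χ ≤ m`, whence `‖χ‖ = 1`. If `Z > N`,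
the net charge attracts, and any widely spread bump has negative energy because the Coulomb energy
decays more slowly under dilation than the kinetic energy; among the combinations of `n + 1` such
bumps with disjoint supports, one is orthogonal to the `n` orbitals.
-/

open MeasureTheory Filter Topology Set
open scoped ENNReal SchwartzMap LineDeriv

noncomputable section

namespace KohnSham

open FourierTransform TemperedDistribution
open scoped Real NNReal

/-! ### Fourier multipliers on `L²` -/

section LpNorm

variable {α : Type*} [MeasurableSpace α] {ν : Measure α}

theorem norm_sq_eq_integral (f : Lp ℂ 2 ν) : ‖f‖ ^ 2 = ∫ x, ‖f x‖ ^ 2 ∂ν := by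
  rw [← inner_self_eq_norm_sq (𝕜 := ℂ) f, L2.inner_def, ← integral_re (L2.integrable_inner f f)]
  simp only [inner_self_eq_norm_sq]

theorem eLpNorm_two_sq {F : Type*} [NormedAddCommGroup F] (v : α → F) :
    eLpNorm v 2 ν ^ 2 = ∫⁻ x, ‖v x‖ₑ ^ 2 ∂ν := by
  simpa using eLpNorm_nnreal_pow_eq_lintegral (f := v) (μ := ν) two_ne_zero

theorem integrable_norm_sq (f : Lp ℂ 2 ν) : Integrable (fun x => ‖f x‖ ^ 2) ν :=
  (Lp.memLp f).integrable_norm_pow (p := 2) two_ne_zero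

/-- Multiplication by a bounded function, as an operator on `L²`. -/
def mulOp (g : α → ℂ) (hg : MemLp g ∞ ν) : Lp ℂ 2 ν →L[ℂ] Lp ℂ 2 ν :=
  (ContinuousLinearMap.mul ℂ ℂ).holderL ν ∞ 2 2 (hg.toLp g)

theorem coeFn_mulOp (g : α → ℂ) (hg : MemLp g ∞ ν) (f : Lp ℂ 2 ν) :
    mulOp g hg f =ᵐ[ν] fun x => g x * f x := by
  filter_upwards [(ContinuousLinearMap.mul ℂ ℂ).coeFn_holder (r := 2) (hg.toLp g) f,
    hg.coeFn_toLp] with x hx hgx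
  exact hx.trans (by rw [hgx]; rfl)

theorem mulOp_eq_add_compl {g : α → ℂ} (hg : MemLp g ∞ ν) {T : Set α} (hT : MeasurableSet T)
    (f : Lp ℂ 2 ν) :
    mulOp g hg f = mulOp _ (hg.indicator hT) f + mulOp _ (hg.indicator hT.compl) f := by
  ext1
  filter_upwards [coeFn_mulOp g hg f, coeFn_mulOp _ (hg.indicator hT) f,
    coeFn_mulOp _ (hg.indicator hT.compl) f,
    Lp.coeFn_add (mulOp _ (hg.indicator hT) f) (mulOp _ (hg.indicator hT.compl) f)]
    with x hx hx₁ hx₂ hadd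
  rw [hadd, Pi.add_apply, hx, hx₁, hx₂, ← add_mul, ← Pi.add_apply (T.indicator g),
    indicator_self_add_compl]

end LpNorm

section FourierMultiplier

variable {E : Type*} [NormedAddCommGroup E] [InnerProductSpace ℝ E] [FiniteDimensional ℝ E]
  [MeasurableSpace E] [BorelSpace E]

/-- The Fourier multiplier with bounded symbol `g`, as an operator on `L²`. -/
def fourierMul (g : E → ℂ) (hg : MemLp g ∞ (volume : Measure E)) :
    Lp ℂ 2 (volume : Measure E) →L[ℂ] Lp ℂ 2 (volume : Measure E) :=
  (Lp.fourierTransformₗᵢ E ℂ).symm.toContinuousLinearEquiv.toContinuousLinearMap ∘L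
    mulOp g hg ∘L (Lp.fourierTransformₗᵢ E ℂ).toContinuousLinearEquiv.toContinuousLinearMap

theorem fourierMul_apply (g : E → ℂ) (hg : MemLp g ∞ (volume : Measure E))
    (f : Lp ℂ 2 (volume : Measure E)) : fourierMul g hg f = 𝓕⁻ (mulOp g hg (𝓕 f)) := rfl

theorem norm_sq_fourierMul (g : E → ℂ) (hg : MemLp g ∞ (volume : Measure E))
    (f : Lp ℂ 2 (volume : Measure E)) :
    ‖fourierMul g hg f‖ ^ 2 =
      ∫ ξ, ‖g ξ‖ ^ 2 * ‖(𝓕 f : Lp ℂ 2 (volume : Measure E)) ξ‖ ^ 2 := by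
  rw [fourierMul_apply, ← Lp.norm_fourier_eq, fourier_fourierInv_eq, norm_sq_eq_integral]
  refine integral_congr_ae ?_
  filter_upwards [coeFn_mulOp g hg (𝓕 f)] with ξ hξ
  rw [hξ, norm_mul, mul_pow]

theorem integrable_norm_sq_mul_fourier (g : E → ℂ) (hg : MemLp g ∞ (volume : Measure E))
    (f : Lp ℂ 2 (volume : Measure E)) :
    Integrable (fun ξ => ‖g ξ‖ ^ 2 * ‖(𝓕 f : Lp ℂ 2 (volume : Measure E)) ξ‖ ^ 2) := by
  refine (integrable_norm_sq (mulOp g hg (𝓕 f))).congr ?_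
  filter_upwards [coeFn_mulOp g hg (𝓕 f)] with ξ hξ
  rw [hξ, norm_mul, mul_pow]

theorem norm_fourierMul_le {g : E → ℂ} (hg : MemLp g ∞ (volume : Measure E)) {M : ℝ}
    (hM : ∀ ξ, ‖g ξ‖ ≤ M) (f : Lp ℂ 2 (volume : Measure E)) :
    ‖fourierMul g hg f‖ ≤ M * ‖f‖ := by
  rw [fourierMul_apply, ← Lp.norm_fourier_eq, fourier_fourierInv_eq, ← Lp.norm_fourier_eq f]
  refine Lp.norm_le_mul_norm_of_ae_le_mul ?_
  filter_upwards [coeFn_mulOp g hg (𝓕 f)] with ξ hξ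
  rw [hξ, norm_mul]
  gcongr
  exact hM ξ

theorem fourierMul_eq_add_compl {g : E → ℂ} (hg : MemLp g ∞ (volume : Measure E)) {T : Set E}
    (hT : MeasurableSet T) (f : Lp ℂ 2 (volume : Measure E)) :
    fourierMul g hg f =
      fourierMul _ (hg.indicator hT) f + fourierMul _ (hg.indicator hT.compl) f := by
  simp only [fourierMul_apply, mulOp_eq_add_compl hg hT, FourierTransform.fourierInv_add]

theorem toTemperedDistribution_fourierMul {g : E → ℂ} (hg : MemLp g ∞ (volume : Measure E))
    (hg' : g.HasTemperateGrowth) (f : Lp ℂ 2 (volume : Measure E)) :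
    (fourierMul g hg f : 𝓢'(E, ℂ)) = fourierMultiplierCLM ℂ g (f : 𝓢'(E, ℂ)) := by
  have hsmul : mulOp g hg (𝓕 f) =
      (hg.toLp g • (𝓕 f : Lp ℂ 2 (volume : Measure E)) : Lp ℂ 2 (volume : Measure E)) := by
    ext1
    filter_upwards [coeFn_mulOp g hg (𝓕 f), hg.coeFn_toLp,
      Lp.coeFn_lpSMul (r := 2) (hg.toLp g) (𝓕 f : Lp ℂ 2 (volume : Measure E))] with ξ hmul hgξ hsm
    rw [hmul, hsm, Pi.smul_apply', hgξ, smul_eq_mul]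
  rw [fourierMul_apply, ← Lp.fourierInv_toTemperedDistribution_eq, hsmul,
    Lp.toTemperedDistribution_smul_eq hg' hg, fourierMultiplierCLM_apply,
    Lp.fourier_toTemperedDistribution_eq]

theorem toTemperedDistribution_injective {f g : Lp ℂ 2 (volume : Measure E)}
    (h : (f : 𝓢'(E, ℂ)) = (g : 𝓢'(E, ℂ))) : f = g :=
  LinearMap.ker_eq_bot.1
    (Lp.ker_toTemperedDistributionCLM_eq_bot (F := ℂ) (μ := (volume : Measure E)) (p := 2)) h

end FourierMultiplier

/-! ### The Bessel potential of order `-1` -/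

section Bessel

variable {E : Type*} [NormedAddCommGroup E]

/-- The symbol `(1 + |ξ|²)^(-1/2)`. -/
def besselSymbol (ξ : E) : ℂ := (((1 + ‖ξ‖ ^ 2) ^ (-1 / 2 : ℝ) : ℝ) : ℂ)

theorem norm_sq_besselSymbol (ξ : E) : ‖besselSymbol ξ‖ ^ 2 = (1 + ‖ξ‖ ^ 2)⁻¹ := by
  have h : (0 : ℝ) < 1 + ‖ξ‖ ^ 2 := by positivity
  rw [besselSymbol, Complex.norm_real, Real.norm_eq_abs, sq_abs, ← Real.rpow_natCast,
    ← Real.rpow_mul h.le]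
  norm_num [Real.rpow_neg_one]

theorem norm_besselSymbol_le_one (ξ : E) : ‖besselSymbol ξ‖ ≤ 1 := by
  rw [← sq_le_one_iff₀ (norm_nonneg _), norm_sq_besselSymbol]
  exact inv_le_one_of_one_le₀ (le_add_of_nonneg_right (sq_nonneg _))

theorem norm_besselSymbol_le_inv {R : ℝ} (hR : 0 < R) {ξ : E} (hξ : R ≤ ‖ξ‖) :
    ‖besselSymbol ξ‖ ≤ R⁻¹ := by
  refine le_of_sq_le_sq ?_ (by positivity)
  rw [norm_sq_besselSymbol, inv_pow]
  gcongr
  nlinarith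

variable [InnerProductSpace ℝ E]

/-- The symbol `2πi ⟨ξ, m⟩ (1 + |ξ|²)^(-1/2)` of the derivative in the direction `m` of the Bessel
potential of order `-1`. -/
def rieszSymbol (m : E) : E → ℂ :=
  (2 * π * Complex.I) • ((fun ξ : E => ((inner ℝ ξ m : ℝ) : ℂ)) * besselSymbol)

theorem norm_sq_rieszSymbol (m ξ : E) :
    ‖rieszSymbol m ξ‖ ^ 2 = 4 * π ^ 2 * ‖inner ℝ ξ m‖ ^ 2 * (1 + ‖ξ‖ ^ 2)⁻¹ := by
  simp only [rieszSymbol, Pi.smul_apply, Pi.mul_apply, norm_smul, norm_mul, mul_pow,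
    norm_sq_besselSymbol, Complex.norm_real, Complex.norm_I, Real.norm_eq_abs, sq_abs]
  norm_num
  ring

theorem norm_rieszSymbol_le (m ξ : E) : ‖rieszSymbol m ξ‖ ≤ 2 * π * ‖m‖ := by
  rw [← sq_le_sq₀ (norm_nonneg _) (by positivity), norm_sq_rieszSymbol, ← div_eq_mul_inv,
    div_le_iff₀ (by positivity)]
  have h : ‖inner ℝ ξ m‖ ^ 2 ≤ ‖ξ‖ ^ 2 * ‖m‖ ^ 2 := by
    rw [← mul_pow]
    exact pow_le_pow_left₀ (norm_nonneg _) (norm_inner_le_norm ξ m) 2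
  calc 4 * π ^ 2 * ‖inner ℝ ξ m‖ ^ 2 ≤ 4 * π ^ 2 * (‖ξ‖ ^ 2 * ‖m‖ ^ 2) := by gcongr
    _ ≤ (2 * π * ‖m‖) ^ 2 * (1 + ‖ξ‖ ^ 2) := by nlinarith [sq_nonneg (π * ‖m‖)]

theorem sum_norm_sq_rieszSymbol {ι : Type*} [Fintype ι] (b : OrthonormalBasis ι ℝ E) (ξ : E) :
    ∑ i, ‖rieszSymbol (b i) ξ‖ ^ 2 = 4 * π ^ 2 * (1 - ‖besselSymbol ξ‖ ^ 2) := by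
  simp_rw [norm_sq_rieszSymbol, norm_sq_besselSymbol, ← Finset.sum_mul, ← Finset.mul_sum,
    b.sum_sq_norm_inner_left]
  field_simp
  ring

theorem hasTemperateGrowth_inner_left (m : E) :
    (fun ξ : E => ((inner ℝ ξ m : ℝ) : ℂ)).HasTemperateGrowth := by fun_prop

theorem hasTemperateGrowth_besselSymbol : (besselSymbol (E := E)).HasTemperateGrowth := by
  unfold besselSymbol; fun_prop

theorem hasTemperateGrowth_rieszSymbol (m : E) : (rieszSymbol m).HasTemperateGrowth :=
  (Function.HasTemperateGrowth.const _).mul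
    ((hasTemperateGrowth_inner_left m).mul hasTemperateGrowth_besselSymbol)

variable [FiniteDimensional ℝ E] [MeasurableSpace E] [BorelSpace E]

theorem memLp_besselSymbol : MemLp besselSymbol ∞ (volume : Measure E) :=
  memLp_top_of_bound hasTemperateGrowth_besselSymbol.1.continuous.aestronglyMeasurable 1
    (Eventually.of_forall norm_besselSymbol_le_one)

theorem memLp_rieszSymbol (m : E) : MemLp (rieszSymbol m) ∞ (volume : Measure E) :=
  memLp_top_of_bound (hasTemperateGrowth_rieszSymbol m).1.continuous.aestronglyMeasurable _
    (Eventually.of_forall (norm_rieszSymbol_le m))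

/-- The Bessel potential `(1 - (2π)⁻² Δ)^(-1/2)` on `L²`. It is a bijection of `L²` onto `H¹`, so
that `f` with `bessel f = u` parametrises `u ∈ H¹` and `‖f‖` is an equivalent norm of `u`. -/
def bessel : Lp ℂ 2 (volume : Measure E) →L[ℂ] Lp ℂ 2 (volume : Measure E) :=
  fourierMul besselSymbol memLp_besselSymbol

theorem norm_bessel_le (f : Lp ℂ 2 (volume : Measure E)) : ‖bessel f‖ ≤ ‖f‖ := by
  simpa only [bessel, one_mul] using
    norm_fourierMul_le memLp_besselSymbol norm_besselSymbol_le_one f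

theorem toTemperedDistribution_bessel (f : Lp ℂ 2 (volume : Measure E)) :
    (bessel f : 𝓢'(E, ℂ)) = besselPotential E ℂ (-1) (f : 𝓢'(E, ℂ)) :=
  toTemperedDistribution_fourierMul _ hasTemperateGrowth_besselSymbol f

theorem bessel_injective :
    Function.Injective (bessel : Lp ℂ 2 (volume : Measure E) → Lp ℂ 2 (volume : Measure E)) := by
  intro f g h
  have h' := congrArg (fun u : Lp ℂ 2 (volume : Measure E) =>
    besselPotential E ℂ 1 (u : 𝓢'(E, ℂ))) h
  simp only [toTemperedDistribution_bessel, besselPotential_besselPotential_apply,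
    neg_add_cancel, besselPotential_zero] at h'
  exact toTemperedDistribution_injective h'

theorem bessel_toLp (u : 𝓢(E, ℂ)) :
    bessel (u.toLp 2) = (SchwartzMap.fourierMultiplierCLM ℂ besselSymbol u).toLp 2 := by
  refine toTemperedDistribution_injective ?_
  rw [bessel, toTemperedDistribution_fourierMul _ hasTemperateGrowth_besselSymbol,
    Lp.toTemperedDistribution_toLp_eq, Lp.toTemperedDistribution_toLp_eq,
    fourierMultiplierCLM_toTemperedDistributionCLM_eq hasTemperateGrowth_besselSymbol]

theorem lineDerivOp_bessel (m : E) (f : Lp ℂ 2 (volume : Measure E)) :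
    ∂_{m} (bessel f : 𝓢'(E, ℂ)) =
      (fourierMul (rieszSymbol m) (memLp_rieszSymbol m) f : 𝓢'(E, ℂ)) := by
  have h := hasTemperateGrowth_inner_left m
  rw [lineDeriv_eq_fourierMultiplierCLM, bessel,
    toTemperedDistribution_fourierMul _ hasTemperateGrowth_besselSymbol,
    toTemperedDistribution_fourierMul _ (hasTemperateGrowth_rieszSymbol m),
    fourierMultiplierCLM_fourierMultiplierCLM_apply hasTemperateGrowth_besselSymbol h,
    mul_comm besselSymbol, rieszSymbol,
    fourierMultiplierCLM_smul (h.mul hasTemperateGrowth_besselSymbol)]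
  rfl

theorem sum_norm_sq_fourierMul_rieszSymbol {ι : Type*} [Fintype ι] (b : OrthonormalBasis ι ℝ E)
    (f : Lp ℂ 2 (volume : Measure E)) :
    ∑ i, ‖fourierMul _ (memLp_rieszSymbol (b i)) f‖ ^ 2 =
      4 * π ^ 2 * (‖f‖ ^ 2 - ‖bessel f‖ ^ 2) := by
  simp_rw [norm_sq_fourierMul]
  rw [← integral_finsetSum _ fun i _ => integrable_norm_sq_mul_fourier _ (memLp_rieszSymbol _) f]
  simp_rw [← Finset.sum_mul, sum_norm_sq_rieszSymbol]
  rw [bessel, norm_sq_fourierMul, ← Lp.norm_fourier_eq f, norm_sq_eq_integral,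
    ← integral_sub (integrable_norm_sq _) (integrable_norm_sq_mul_fourier _ memLp_besselSymbol f),
    ← integral_const_mul]
  congr 1; ext ξ; ring

theorem mem_H1_iff {u : L2} : u ∈ H1 ↔ ∃ f, bessel f = u := by
  constructor
  · rintro ⟨f, hf⟩
    refine ⟨f, toTemperedDistribution_injective ?_⟩
    rw [toTemperedDistribution_bessel, besselPotential_neg_apply_eq_iff, hf]
  · rintro ⟨f, rfl⟩
    refine ⟨f, ?_⟩
    rw [toTemperedDistribution_bessel, besselPotential_besselPotential_apply, neg_add_cancel,
      besselPotential_zero]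
    rfl

theorem weakPartial_eq {i : Fin 3} {u g : L2} (h : IsWeakPartial i u g) : weakPartial i u = g := by
  have hex : ∃ g, IsWeakPartial i u g := ⟨g, h⟩
  rw [weakPartial, dif_pos hex]
  exact hex.choose_spec.unique h

theorem weakPartial_bessel (i : Fin 3) (f : L2) :
    weakPartial i (bessel f) = fourierMul _ (memLp_rieszSymbol (EuclideanSpace.single i 1)) f :=
  weakPartial_eq (lineDerivOp_bessel _ f)

theorem integral_sum_weakPartial_bessel (f : L2) :
    ∫ x, ∑ i, ‖weakPartial i (bessel f) x‖ ^ 2 = 4 * π ^ 2 * (‖f‖ ^ 2 - ‖bessel f‖ ^ 2) := by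
  rw [integral_finsetSum _ fun i _ => integrable_norm_sq _]
  simp_rw [← norm_sq_eq_integral, weakPartial_bessel]
  simpa only [EuclideanSpace.basisFun_apply] using
    sum_norm_sq_fourierMul_rieszSymbol (EuclideanSpace.basisFun (Fin 3) ℝ) f

end Bessel

/-! ### The Sobolev inequality -/

section GagliardoNirenberg

variable {E F : Type*} [NormedAddCommGroup E] [NormedSpace ℝ E] [FiniteDimensional ℝ E]
  [NormedAddCommGroup F] [NormedSpace ℝ F]

theorem exists_norm_fderiv_bump_le (φ : ContDiffBump (0 : E)) :
    ∃ K : ℝ≥0, ∀ x, ‖fderiv ℝ φ x‖ ≤ K := by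
  have hcont : Continuous (fderiv ℝ φ) := (φ.contDiff (n := 1)).continuous_fderiv one_ne_zero
  obtain ⟨K, hK⟩ := (φ.hasCompactSupport.fderiv (𝕜 := ℝ)).exists_bound_of_continuous hcont
  exact ⟨K.toNNReal, fun x => (hK x).trans (Real.le_coe_toNNReal K)⟩

theorem norm_fderiv_bump_smul_le (φ : ContDiffBump (0 : E)) {K : ℝ≥0}
    (hK : ∀ x, ‖fderiv ℝ φ x‖ ≤ K) {u : E → F} (hu : Differentiable ℝ u) (r : ℝ≥0) (x : E) :
    ‖fderiv ℝ (fun y => φ (r • y) • u y) x‖ ≤ ‖fderiv ℝ u x‖ + (r * K : ℝ≥0) * ‖u x‖ := by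
  have hφ : DifferentiableAt ℝ (fun y => φ (r • y)) x :=
    ((φ.contDiff (n := 1)).comp (contDiff_const_smul r)).differentiable one_ne_zero x
  rw [fderiv_fun_smul hφ (hu x)]
  refine (norm_add_le _ _).trans (add_le_add ?_ ?_)
  · rw [norm_smul, Real.norm_of_nonneg φ.nonneg]
    exact mul_le_of_le_one_left (norm_nonneg _) φ.le_one
  · rw [ContinuousLinearMap.norm_smulRight_apply]
    have h := fderiv_comp_smul (𝕜 := ℝ) (f := φ) (x := x) (r : ℝ)
    change fderiv ℝ (fun y => φ (r • y)) x = _ at h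
    rw [h, norm_smul, Real.norm_of_nonneg r.coe_nonneg]
    push_cast
    gcongr
    exact hK _

variable [MeasurableSpace E] [BorelSpace E] {μ : Measure E}

theorem eLpNorm_fderiv_bump_smul_le (φ : ContDiffBump (0 : E)) {K : ℝ≥0}
    (hK : ∀ x, ‖fderiv ℝ φ x‖ ≤ K) {u : E → F} (hu : ContDiff ℝ 1 u) (r : ℝ≥0) {p : ℝ≥0∞}
    (hp : 1 ≤ p) :
    eLpNorm (fderiv ℝ fun y => φ (r • y) • u y) p μ ≤
      eLpNorm (fderiv ℝ u) p μ + (r * K : ℝ≥0) * eLpNorm u p μ := by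
  have hdu := (hu.continuous_fderiv one_ne_zero).norm.aestronglyMeasurable (μ := μ)
  have hu' := (hu.continuous.norm.const_smul ((r * K : ℝ≥0) : ℝ)).aestronglyMeasurable (μ := μ)
  have hmono := eLpNorm_mono_real (μ := μ) (p := p)
    (norm_fderiv_bump_smul_le φ hK (hu.differentiable one_ne_zero) r)
  refine (hmono.trans (eLpNorm_add_le hdu hu' hp)).trans_eq ?_
  rw [eLpNorm_norm]
  congr 1
  exact (eLpNorm_const_smul ((r * K : ℝ≥0) : ℝ) _ p μ).trans (by simp)

theorem eLpNorm_le_eLpNorm_fderiv_of_memLp [FiniteDimensional ℝ F] [μ.IsAddHaarMeasure]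
    {u : E → F} (hu : ContDiff ℝ 1 u) {p p' : ℝ≥0} (hup : MemLp u p μ) (hp : 1 ≤ p)
    (hE : 0 < Module.finrank ℝ E) (hp' : (p' : ℝ)⁻¹ = p⁻¹ - (Module.finrank ℝ E : ℝ)⁻¹) :
    eLpNorm u p' μ ≤ SNormLESNormFDerivOfEqConst F μ p * eLpNorm (fderiv ℝ u) p μ := by
  let φ : ContDiffBump (0 : E) := ⟨1, 2, one_pos, one_lt_two⟩
  obtain ⟨K, hK⟩ := exists_norm_fderiv_bump_le φ
  let r (k : ℕ) : ℝ≥0 := 1 / (k + 1)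
  have hr : Tendsto r atTop (𝓝 0) := tendsto_one_div_add_atTop_nhds_zero_nat
  have hcutoff (k : ℕ) : ContDiff ℝ 1 fun y => φ (r k • y) • u y :=
    ((φ.contDiff (n := 1)).comp (contDiff_const_smul (r k))).smul hu
  have hbound (k : ℕ) : eLpNorm (fun y => φ (r k • y) • u y) p' μ ≤
      SNormLESNormFDerivOfEqConst F μ p *
        (eLpNorm (fderiv ℝ u) p μ + (r k * K : ℝ≥0) * eLpNorm u p μ) := by
    have hsupp : HasCompactSupport fun y => φ (r k • y) :=
      φ.hasCompactSupport.comp_smul (c := (r k : ℝ)) (by positivity)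
    refine (eLpNorm_le_eLpNorm_fderiv_of_eq μ (hcutoff k) hsupp.smul_right hp hE hp').trans ?_
    gcongr
    exact eLpNorm_fderiv_bump_smul_le φ hK hu (r k) (by exact_mod_cast hp)
  have hlim : Tendsto (fun k => SNormLESNormFDerivOfEqConst F μ p *
      (eLpNorm (fderiv ℝ u) p μ + (r k * K : ℝ≥0) * eLpNorm u p μ)) atTop
      (𝓝 (SNormLESNormFDerivOfEqConst F μ p * eLpNorm (fderiv ℝ u) p μ)) := by
    have hrK : Tendsto (fun k => ((r k * K : ℝ≥0) : ℝ≥0∞)) atTop (𝓝 0) := by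
      simpa using ENNReal.tendsto_coe.2 (hr.mul_const K)
    have h := ENNReal.Tendsto.mul_const hrK (Or.inr hup.2.ne)
    simpa using ENNReal.Tendsto.const_mul (h.const_add (eLpNorm (fderiv ℝ u) p μ))
      (Or.inr ENNReal.coe_ne_top)
  refine (Lp.eLpNorm_lim_le_liminf_eLpNorm
    (fun k => (hcutoff k).continuous.aestronglyMeasurable) u
      (Eventually.of_forall fun x => ?_)).trans
        ((liminf_le_liminf (Eventually.of_forall hbound)).trans_eq hlim.liminf_eq)
  have hrx : Tendsto (fun k => r k • x) atTop (𝓝 0) := by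
    simpa [NNReal.smul_def] using (NNReal.tendsto_coe.2 hr).smul_const x
  refine tendsto_const_nhds.congr' ?_
  filter_upwards [hrx (φ.eventuallyEq_one)] with k hk
  simp only [mem_preimage, mem_ofPred_eq, Pi.one_apply] at hk
  rw [hk, one_smul]

end GagliardoNirenberg

section Sobolev

variable {E : Type*} [NormedAddCommGroup E] [InnerProductSpace ℝ E]

theorem opNorm_sq_le_sum_norm_sq {F : Type*} [NormedAddCommGroup F] [NormedSpace ℝ F]
    {ι : Type*} [Fintype ι] (b : OrthonormalBasis ι ℝ E) (T : E →L[ℝ] F) :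
    ‖T‖ ^ 2 ≤ ∑ i, ‖T (b i)‖ ^ 2 := by
  rw [← Real.le_sqrt (norm_nonneg T) (by positivity)]
  refine T.opNorm_le_bound (by positivity) fun x => ?_
  calc ‖T x‖ = ‖∑ i, inner ℝ (b i) x • T (b i)‖ := by
        conv_lhs => rw [← b.sum_repr' x, map_sum]
        simp only [map_smul]
    _ ≤ ∑ i, ‖T (b i)‖ * ‖inner ℝ (b i) x‖ := by
        refine (norm_sum_le _ _).trans_eq (Finset.sum_congr rfl fun i _ => ?_)
        rw [norm_smul, mul_comm]
    _ ≤ √(∑ i, ‖T (b i)‖ ^ 2) * √(∑ i, ‖inner ℝ (b i) x‖ ^ 2) :=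
        Real.sum_mul_le_sqrt_mul_sqrt _ _ _
    _ = √(∑ i, ‖T (b i)‖ ^ 2) * ‖x‖ := by
        rw [b.sum_sq_norm_inner_right, Real.sqrt_sq (norm_nonneg x)]

variable [FiniteDimensional ℝ E] [MeasurableSpace E] [BorelSpace E]

theorem enorm_toLp_eq_eLpNorm (u : 𝓢(E, ℂ)) :
    ‖u.toLp 2 (volume : Measure E)‖ₑ = eLpNorm u 2 volume := by
  rw [Lp.enorm_def, eLpNorm_congr_ae (u.coeFn_toLp 2 volume)]

theorem eLpNorm_fderiv_sq_le_sum {ι : Type*} [Fintype ι] (b : OrthonormalBasis ι ℝ E)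
    (u : 𝓢(E, ℂ)) :
    eLpNorm (fderiv ℝ u) 2 volume ^ 2 ≤
      ∑ i, ‖(∂_{b i} u : 𝓢(E, ℂ)).toLp 2 (volume : Measure E)‖ₑ ^ 2 := by
  simp_rw [enorm_toLp_eq_eLpNorm, eLpNorm_two_sq]
  rw [← lintegral_finsetSum _ fun i _ => by fun_prop]
  refine lintegral_mono fun x => ?_
  have h := ENNReal.ofReal_le_ofReal (opNorm_sq_le_sum_norm_sq b (fderiv ℝ u x))
  rw [ENNReal.ofReal_sum_of_nonneg fun i _ => by positivity] at h
  simpa only [ENNReal.ofReal_pow (norm_nonneg _), ofReal_norm,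
    SchwartzMap.lineDerivOp_apply_eq_fderiv] using h

theorem toLp_lineDerivOp_of_toLp_eq_bessel {u : 𝓢(E, ℂ)} {f : Lp ℂ 2 (volume : Measure E)}
    (hu : u.toLp 2 = bessel f) (m : E) :
    (∂_{m} u : 𝓢(E, ℂ)).toLp 2 = fourierMul _ (memLp_rieszSymbol m) f := by
  refine toTemperedDistribution_injective ?_
  rw [← lineDerivOp_bessel, ← hu, Lp.toTemperedDistribution_toLp_eq,
    Lp.toTemperedDistribution_toLp_eq, lineDerivOp_toTemperedDistributionCLM_eq]

theorem eLpNorm_fderiv_le_of_toLp_eq_bessel {u : 𝓢(E, ℂ)} {f : Lp ℂ 2 (volume : Measure E)}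
    (hu : u.toLp 2 = bessel f) :
    eLpNorm (fderiv ℝ u) 2 volume ≤ (2 * NNReal.pi : ℝ≥0) * ‖f‖ₑ := by
  let b := stdOrthonormalBasis ℝ E
  have hsum : ∑ i, ‖fourierMul _ (memLp_rieszSymbol (b i)) f‖ ^ 2 ≤ (2 * π * ‖f‖) ^ 2 := by
    rw [sum_norm_sq_fourierMul_rieszSymbol]
    nlinarith [mul_nonneg (sq_nonneg π) (sq_nonneg ‖bessel f‖)]
  rw [← ENNReal.pow_le_pow_left_iff two_ne_zero]
  refine (eLpNorm_fderiv_sq_le_sum b u).trans ?_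
  have h := ENNReal.ofReal_le_ofReal hsum
  rw [ENNReal.ofReal_sum_of_nonneg fun i _ => by positivity,
    ← NNReal.coe_real_pi, ← NNReal.coe_two, ← NNReal.coe_mul, ENNReal.ofReal_pow (by positivity),
    ENNReal.ofReal_mul (by positivity), ENNReal.ofReal_coe_nnreal] at h
  simpa only [toLp_lineDerivOp_of_toLp_eq_bessel hu, ENNReal.ofReal_pow (norm_nonneg _),
    ofReal_norm] using h

theorem exists_eLpNorm_bessel_le {p' : ℝ≥0} (hE : 0 < Module.finrank ℝ E)
    (hp' : (p' : ℝ)⁻¹ = 2⁻¹ - (Module.finrank ℝ E : ℝ)⁻¹) :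
    ∃ C : ℝ≥0, ∀ f : Lp ℂ 2 (volume : Measure E), eLpNorm (bessel f) p' volume ≤ C * ‖f‖ₑ := by
  refine ⟨SNormLESNormFDerivOfEqConst ℂ (volume : Measure E) ((2 : ℝ≥0) : ℝ) * (2 * NNReal.pi),
    fun f => ?_⟩
  obtain ⟨v, hv, hlim⟩ := mem_closure_iff_seq_limit.1
    (SchwartzMap.denseRange_toLpCLM (E := E) (F := ℂ) (p := 2) (μ := volume)
      ENNReal.ofNat_ne_top f)
  choose u hu using hv
  have hSchwartz (k : ℕ) : eLpNorm (bessel (v k)) p' volume ≤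
      (SNormLESNormFDerivOfEqConst ℂ (volume : Measure E) ((2 : ℝ≥0) : ℝ) * (2 * NNReal.pi) : ℝ≥0) *
        ‖v k‖ₑ := by
    have hbessel : bessel (v k) = _ := (congrArg bessel (hu k).symm).trans (bessel_toLp (u k))
    have hw := SchwartzMap.memLp (SchwartzMap.fourierMultiplierCLM ℂ besselSymbol (u k)) 2
      (volume : Measure E)
    rw [hbessel, eLpNorm_congr_ae (SchwartzMap.coeFn_toLp _ 2 volume), ENNReal.coe_mul, mul_assoc]
    refine (eLpNorm_le_eLpNorm_fderiv_of_memLp (p := 2) (SchwartzMap.smooth _ 1) hw one_le_two hE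
      hp').trans ?_
    gcongr
    exact eLpNorm_fderiv_le_of_toLp_eq_bessel hbessel.symm
  obtain ⟨ns, hns, hae⟩ := (tendstoInMeasure_of_tendsto_Lp
    ((bessel.continuous.tendsto f).comp hlim)).exists_seq_tendsto_ae
  refine (Lp.eLpNorm_lim_le_liminf_eLpNorm (fun k => Lp.aestronglyMeasurable _) _ hae).trans
    ((liminf_le_liminf (Eventually.of_forall fun k => hSchwartz (ns k))).trans_eq ?_)
  exact (ENNReal.Tendsto.const_mul (hlim.comp hns.tendsto_atTop).enorm
    (Or.inr ENNReal.coe_ne_top)).liminf_eq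

end Sobolev

/-! ### Weak convergence in Hilbert spaces -/

section WeakConvergence

variable {H H' : Type*} [NormedAddCommGroup H] [InnerProductSpace ℂ H] [NormedAddCommGroup H']
  [InnerProductSpace ℂ H']

/-- Weak convergence of a sequence in a complex Hilbert space. -/
def WeakTendsto (f : ℕ → H) (a : H) : Prop :=
  ∀ g, Tendsto (fun k => inner ℂ g (f k)) atTop (𝓝 (inner ℂ g a))

theorem WeakTendsto.of_tendsto {f : ℕ → H} {a : H} (hf : Tendsto f atTop (𝓝 a)) :
    WeakTendsto f a :=
  fun _ => tendsto_const_nhds.inner hf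

theorem WeakTendsto.sub_const {f : ℕ → H} {a : H} (hf : WeakTendsto f a) :
    WeakTendsto (fun k => f k - a) 0 := fun g => by
  simpa only [inner_sub_right, inner_zero_right, sub_self] using (hf g).sub_const (inner ℂ g a)

theorem WeakTendsto.tendsto_re_inner {f : ℕ → H} {a : H} (hf : WeakTendsto f a) (g : H) :
    Tendsto (fun k => RCLike.re (inner ℂ g (f k))) atTop (𝓝 (RCLike.re (inner ℂ g a))) :=
  (RCLike.continuous_re.tendsto _).comp (hf g)

theorem WeakTendsto.norm_le {f : ℕ → H} {a : H} (hf : WeakTendsto f a) {B : ℝ}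
    (hB : ∀ k, ‖f k‖ ≤ B) : ‖a‖ ≤ B := by
  have h : ‖a‖ ^ 2 ≤ ‖a‖ * B := by
    rw [← inner_self_eq_norm_sq (𝕜 := ℂ)]
    refine le_of_tendsto' (hf.tendsto_re_inner a) fun k => (re_inner_le_norm _ _).trans ?_
    gcongr
    exact hB k
  rcases (norm_nonneg a).eq_or_lt with ha | ha
  · exact ha.symm.trans_le ((norm_nonneg _).trans (hB 0))
  · exact le_of_mul_le_mul_left (by rwa [← sq]) ha

theorem WeakTendsto.inner_eq_zero {f : ℕ → H} {a g : H} (hf : WeakTendsto f a)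
    (hg : ∀ k, inner ℂ g (f k) = 0) : inner ℂ g a = 0 :=
  tendsto_nhds_unique (hf g) (by simp only [hg, tendsto_const_nhds_iff])

variable [CompleteSpace H]

theorem WeakTendsto.exists_norm_le {f : ℕ → H} {a : H} (hf : WeakTendsto f a) :
    ∃ B, ∀ k, ‖f k‖ ≤ B := by
  obtain ⟨B, hB⟩ := banach_steinhaus (g := fun k => innerSL ℂ (f k)) fun g => by
    obtain ⟨B, hB⟩ := (hf g).norm.bddAbove_range
    exact ⟨B, fun k => by simpa only [innerSL_apply_apply, norm_inner_symm] using hB ⟨k, rfl⟩⟩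
  exact ⟨B, fun k => by simpa only [innerSL_apply_norm] using hB k⟩

theorem exists_subseq_weakTendsto [TopologicalSpace.SeparableSpace H] {f : ℕ → H} {B : ℝ}
    (hB : ∀ k, ‖f k‖ ≤ B) :
    ∃ (a : H) (φ : ℕ → ℕ), StrictMono φ ∧ WeakTendsto (f ∘ φ) a := by
  obtain ⟨a, -, φ, hφ, ha⟩ := WeakDual.isSeqCompact_closedBall ℂ H 0 B
    (x := fun k => StrongDual.toWeakDual (InnerProductSpace.toDual ℂ H (f k))) fun k => by
      change InnerProductSpace.toDual ℂ H (f k) ∈ Metric.closedBall 0 B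
      rw [mem_closedBall_zero_iff, LinearIsometryEquiv.norm_map]
      exact hB k
  refine ⟨(InnerProductSpace.toDual ℂ H).symm (WeakDual.toStrongDual a), φ, hφ, fun g => ?_⟩
  have hg := (Complex.continuous_conj.tendsto _).comp
    (((WeakDual.eval_continuous g).tendsto a).comp ha)
  rw [← inner_conj_symm, InnerProductSpace.toDual_symm_apply]
  exact hg.congr fun k => inner_conj_symm _ _

variable [CompleteSpace H']

theorem WeakTendsto.map {f : ℕ → H} {a : H} (hf : WeakTendsto f a) (T : H →L[ℂ] H') :
    WeakTendsto (fun k => T (f k)) (T a) := fun g => by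
  simpa only [ContinuousLinearMap.adjoint_inner_left] using hf (T.adjoint g)

/-- For a contraction `T`, the form `‖f‖² - ‖T f‖²` is nonnegative, hence weakly lower
semicontinuous. -/
theorem WeakTendsto.norm_sq_sub_norm_sq_map_le {f : ℕ → H} {a : H} (hf : WeakTendsto f a)
    {T : H →L[ℂ] H'} (hT : ∀ x, ‖T x‖ ≤ ‖x‖) {t : ℝ}
    (ht : Tendsto (fun k => ‖f k‖ ^ 2 - ‖T (f k)‖ ^ 2) atTop (𝓝 t)) :
    ‖a‖ ^ 2 - ‖T a‖ ^ 2 ≤ t := by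
  have hlim := ((hf.sub_const.tendsto_re_inner a).sub
    ((hf.sub_const.map T).tendsto_re_inner (T a))).const_mul 2 |>.const_add (‖a‖ ^ 2 - ‖T a‖ ^ 2)
  simp only [map_zero, inner_zero_right, sub_self, mul_zero, add_zero] at hlim
  refine le_of_tendsto_of_tendsto' hlim ht fun k => ?_
  have hexp := norm_add_sq (𝕜 := ℂ) a (f k - a)
  have hexp' := norm_add_sq (𝕜 := ℂ) (T a) (T (f k - a))
  rw [← map_add, add_sub_cancel] at hexp'
  rw [add_sub_cancel] at hexp
  nlinarith [pow_le_pow_left₀ (norm_nonneg _) (hT (f k - a)) 2]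

end WeakConvergence

/-! ### Local compactness of the Bessel potential -/

section LocalCompactness

variable {E : Type*} [NormedAddCommGroup E] [InnerProductSpace ℝ E] [FiniteDimensional ℝ E]
  [MeasurableSpace E] [BorelSpace E]

theorem coeFn_fourierInv_of_integrable (h : Lp ℂ 2 (volume : Measure E))
    (hi : Integrable h volume) :
    (𝓕⁻ h : Lp ℂ 2 (volume : Measure E)) =ᵐ[volume] 𝓕⁻ (h : E → ℂ) := by
  have hinner : Continuous fun p : E × E => (-innerₗ E) p.1 p.2 := continuous_inner.neg
  have hflip : (-innerₗ E).flip = -innerₗ E := by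
    ext x y
    exact congrArg _ (real_inner_comm x y)
  have hcont : Continuous (𝓕⁻ (h : E → ℂ)) :=
    VectorFourier.fourierIntegral_continuous Real.continuous_fourierChar hinner hi
  refine ae_eq_of_integral_contDiff_smul_eq ((Lp.memLp _).locallyIntegrable one_le_two)
    hcont.locallyIntegrable fun g hg hgs => ?_
  have hG : ContDiff ℝ ((⊤ : ℕ∞) : WithTop ℕ∞) (Complex.ofRealCLM ∘ g) := by fun_prop
  have hGs : HasCompactSupport (Complex.ofRealCLM ∘ g) := hgs.comp_left rfl
  set G : 𝓢(E, ℂ) := hGs.toSchwartzMap hG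
  have hGg (x : E) : G x = (g x : ℂ) := rfl
  calc ∫ x, g x • (𝓕⁻ h : Lp ℂ 2 (volume : Measure E)) x
      = ((𝓕⁻ h : Lp ℂ 2 (volume : Measure E)) : 𝓢'(E, ℂ)) G := by
        simp only [Lp.toTemperedDistribution_apply, hGg, Complex.coe_smul]
    _ = ∫ x, 𝓕⁻ (G : E → ℂ) x • h x := by
        rw [← Lp.fourierInv_toTemperedDistribution_eq, TemperedDistribution.fourierInv_apply,
          Lp.toTemperedDistribution_apply, SchwartzMap.fourierInv_coe]
    _ = ∫ x, G x • VectorFourier.fourierIntegral 𝐞 volume (-innerₗ E).flip h x :=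
        VectorFourier.integral_fourierIntegral_smul_eq_flip (f := G)
          Real.continuous_fourierChar hinner G.integrable hi
    _ = ∫ x, g x • 𝓕⁻ (h : E → ℂ) x := by
        rw [hflip]
        rfl

theorem exists_kernel_fourierMul {g : E → ℂ} (hg : MemLp g ∞ (volume : Measure E))
    (hg₂ : MemLp g 2 (volume : Measure E)) :
    ∃ κ : E → Lp ℂ 2 (volume : Measure E), (∀ x, ‖κ x‖ = ‖hg₂.toLp g‖) ∧
      ∀ f, fourierMul g hg f =ᵐ[volume] fun x => inner ℂ (κ x) f := by
  let k (x ξ : E) : ℂ := starRingEnd ℂ (((𝐞 (inner ℝ ξ x) : Circle) : ℂ) * g ξ)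
  have hnorm (x ξ : E) : ‖k x ξ‖ = ‖g ξ‖ := by
    simp only [k, RCLike.norm_conj, norm_mul, Circle.norm_coe, one_mul]
  have hk (x : E) : MemLp (k x) 2 (volume : Measure E) := by
    refine hg₂.of_le ?_ (Eventually.of_forall fun ξ => (hnorm x ξ).le)
    have hchar : Continuous fun ξ : E => ((𝐞 (inner ℝ ξ x) : Circle) : ℂ) := by fun_prop
    exact Complex.continuous_conj.comp_aestronglyMeasurable
      (hchar.aestronglyMeasurable.mul hg₂.aestronglyMeasurable)
  refine ⟨fun x => 𝓕⁻ ((hk x).toLp (k x)), fun x => ?_, fun f => ?_⟩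
  · rw [← Lp.norm_fourier_eq, fourier_fourierInv_eq, Lp.norm_toLp, Lp.norm_toLp]
    congr 1
    exact eLpNorm_congr_norm_ae (Eventually.of_forall (hnorm x))
  · have hmul := coeFn_mulOp g hg (𝓕 f)
    have hint : Integrable (mulOp g hg (𝓕 f)) :=
      (hg₂.integrable_mul (Lp.memLp (𝓕 f : Lp ℂ 2 (volume : Measure E)))).congr hmul.symm
    refine (coeFn_fourierInv_of_integrable _ hint).trans (Eventually.of_forall fun x => ?_)
    beta_reduce
    rw [← Lp.inner_fourier_eq, fourier_fourierInv_eq, L2.inner_def, Real.fourierInv_eq]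
    refine integral_congr_ae ?_
    filter_upwards [hmul, (hk x).coeFn_toLp] with ξ hξ hkξ
    rw [hξ, hkξ, Circle.smul_def, RCLike.inner_apply, Complex.conj_conj, smul_eq_mul]
    ring

theorem WeakTendsto.tendsto_eLpNorm_restrict_fourierMul {S : Set E} (hS : volume S ≠ ∞) {g : E → ℂ}
    (hg : MemLp g ∞ (volume : Measure E)) (hg₂ : MemLp g 2 (volume : Measure E))
    {f : ℕ → Lp ℂ 2 (volume : Measure E)} (hf : WeakTendsto f 0) :
    Tendsto (fun k => eLpNorm (fourierMul g hg (f k)) 2 (volume.restrict S)) atTop (𝓝 0) := by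
  obtain ⟨κ, hκ, hκf⟩ := exists_kernel_fourierMul hg hg₂
  obtain ⟨B, hB⟩ := hf.exists_norm_le
  have hlim : Tendsto (fun k => ∫⁻ x in S, ‖fourierMul g hg (f k) x‖ₑ ^ 2) atTop
      (𝓝 (∫⁻ _ in S, 0)) := by
    refine tendsto_lintegral_of_dominated_convergence'
      (fun _ => ENNReal.ofReal (‖hg₂.toLp g‖ * B) ^ 2)
      (fun k => (Lp.aestronglyMeasurable _).enorm.pow_const 2 |>.restrict) (fun k => ?_) ?_ ?_
    · filter_upwards [ae_restrict_of_ae (hκf (f k))] with x hx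
      rw [hx, ← ofReal_norm]
      gcongr
      exact (norm_inner_le_norm _ _).trans (by rw [hκ]; gcongr; exact hB k)
    · rw [lintegral_const, Measure.restrict_apply_univ]
      exact ENNReal.mul_ne_top (ENNReal.pow_ne_top ENNReal.ofReal_ne_top) hS
    · filter_upwards [ae_restrict_of_ae (ae_all_iff.2 fun k => hκf (f k))] with x hx
      simpa [hx] using ENNReal.Tendsto.pow (hf (κ x)).enorm (n := 2)
  simp only [← eLpNorm_two_sq, lintegral_zero] at hlim
  simpa [← ENNReal.rpow_natCast_mul] using hlim.ennrpow_const (1 / 2)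

theorem norm_fourierMul_besselSymbol_indicator_le {R : ℝ} (hR : 0 < R)
    (f : Lp ℂ 2 (volume : Measure E)) :
    ‖fourierMul _ (memLp_besselSymbol.indicator
      (Metric.isClosed_closedBall (x := (0 : E)) (ε := R)).measurableSet.compl) f‖ ≤ R⁻¹ * ‖f‖ := by
  refine norm_fourierMul_le _ (fun ξ => ?_) f
  by_cases hξ : ξ ∈ (Metric.closedBall (0 : E) R)ᶜ
  · rw [indicator_of_mem hξ]
    rw [mem_compl_iff, mem_closedBall_zero_iff, not_le] at hξ
    exact norm_besselSymbol_le_inv hR hξ.le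
  · rw [indicator_of_notMem hξ, norm_zero]
    positivity

/-- A form of the Rellich theorem. -/
theorem WeakTendsto.tendsto_eLpNorm_restrict_bessel {S : Set E} (hS : volume S ≠ ∞)
    {f : ℕ → Lp ℂ 2 (volume : Measure E)} (hf : WeakTendsto f 0) :
    Tendsto (fun k => eLpNorm (bessel (f k)) 2 (volume.restrict S)) atTop (𝓝 0) := by
  obtain ⟨B, hB⟩ := hf.exists_norm_le
  refine ENNReal.tendsto_nhds_zero.2 fun ε hε => ?_
  obtain ⟨R, hRε, hR⟩ : ∃ R : ℝ, ENNReal.ofReal (R⁻¹ * B) < ε / 2 ∧ 0 < R := by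
    have hlim := ENNReal.tendsto_ofReal (tendsto_inv_atTop_zero.mul_const B)
    rw [zero_mul, ENNReal.ofReal_zero] at hlim
    exact ((hlim.eventually_lt_const (ENNReal.half_pos hε.ne')).and (eventually_gt_atTop 0)).exists
  have hT : MeasurableSet (Metric.closedBall (0 : E) R) := Metric.isClosed_closedBall.measurableSet
  have hlow₂ : MemLp ((Metric.closedBall (0 : E) R).indicator besselSymbol) 2
      (volume : Measure E) := by
    have : IsFiniteMeasure ((volume : Measure E).restrict (Metric.closedBall 0 R)) :=
      isFiniteMeasure_restrict.2 measure_closedBall_lt_top.ne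
    exact (memLp_indicator_iff_restrict hT).2 ((memLp_besselSymbol.restrict _).mono_exponent le_top)
  have hlow := hf.tendsto_eLpNorm_restrict_fourierMul hS (memLp_besselSymbol.indicator hT) hlow₂
  filter_upwards [ENNReal.tendsto_nhds_zero.1 hlow _ (ENNReal.half_pos hε.ne')] with k hk
  have hsplit : bessel (f k) = fourierMul _ (memLp_besselSymbol.indicator hT) (f k) +
      fourierMul _ (memLp_besselSymbol.indicator hT.compl) (f k) :=
    fourierMul_eq_add_compl memLp_besselSymbol hT (f k)
  rw [hsplit, eLpNorm_congr_ae (ae_restrict_of_ae (Lp.coeFn_add _ _))]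
  refine (eLpNorm_add_le (Lp.aestronglyMeasurable _).restrict (Lp.aestronglyMeasurable _).restrict
    one_le_two).trans ((add_le_add hk ?_).trans_eq (ENNReal.add_halves ε))
  refine (eLpNorm_restrict_le _ _ _ _).trans (le_trans ?_ hRε.le)
  rw [← Lp.enorm_def, ← ofReal_norm]
  gcongr
  exact (norm_fourierMul_besselSymbol_indicator_le hR _).trans (by gcongr; exact hB k)

end LocalCompactness

/-! ### Potentials in `L³ᐟ² + (L^∞)_ε` and their quadratic forms -/

section MemLpAddEps

variable {α : Type*} [MeasurableSpace α] {ν : Measure α} {p : ℝ≥0∞} {V W : α → ℝ}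

/-- The class `L^p + (L^∞)_ε` of potentials `V` which, for every `ε > 0`, are the sum of a function
in `L^p` and a function bounded by `ε`; here the decomposition is encoded by a domination. -/
def MemLpAddEps (V : α → ℝ) (p : ℝ≥0∞) (ν : Measure α) : Prop :=
  AEStronglyMeasurable V ν ∧
    ∀ ε : ℝ, 0 < ε → ∃ W : α → ℝ, MemLp W p ν ∧ ∀ᵐ x ∂ν, ‖V x‖ ≤ ε + ‖W x‖

theorem MemLpAddEps.add (hV : MemLpAddEps V p ν) (hW : MemLpAddEps W p ν) :
    MemLpAddEps (fun x => V x + W x) p ν := by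
  refine ⟨hV.1.add hW.1, fun ε hε => ?_⟩
  obtain ⟨V', hV', hVV'⟩ := hV.2 (ε / 2) (half_pos hε)
  obtain ⟨W', hW', hWW'⟩ := hW.2 (ε / 2) (half_pos hε)
  refine ⟨fun x => ‖V' x‖ + ‖W' x‖, hV'.norm.add hW'.norm, ?_⟩
  filter_upwards [hVV', hWW'] with x hx hx'
  rw [Real.norm_of_nonneg (by positivity : 0 ≤ ‖V' x‖ + ‖W' x‖)]
  linarith [norm_add_le (V x) (W x)]

theorem MemLpAddEps.neg (hV : MemLpAddEps V p ν) : MemLpAddEps (fun x => -V x) p ν :=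
  ⟨hV.1.neg, fun ε hε => by simpa only [norm_neg] using hV.2 ε hε⟩

theorem MemLpAddEps.exists_enorm_le (hV : MemLpAddEps V p ν) (hp : p ≠ 0) (hp' : p ≠ ∞) {ε : ℝ}
    (hε : 0 < ε) :
    ∃ S, MeasurableSet S ∧ ν S ≠ ∞ ∧ ∃ (M : ℝ≥0) (W : α → ℝ), AEStronglyMeasurable W ν ∧
      eLpNorm W p ν ≤ ENNReal.ofReal ε ∧
      ∀ᵐ x ∂ν, ‖V x‖ₑ ≤ ENNReal.ofReal ε + S.indicator (fun _ => (M : ℝ≥0∞)) x + ‖W x‖ₑ := by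
  obtain ⟨W, hW, hVW⟩ := hV.2 (ε / 2) (half_pos hε)
  have hW' : MemLp (hW.1.mk W) p ν := (memLp_congr_ae hW.1.ae_eq_mk).1 hW
  have hm := hW.1.stronglyMeasurable_mk
  obtain ⟨M, hM⟩ := hW'.eLpNorm_indicator_norm_ge_le hm hε
  set T := {x | M ≤ ‖hW.1.mk W x‖₊}
  set S := {x | (ε / 2).toNNReal ≤ ‖hW.1.mk W x‖₊}
  have hT : MeasurableSet T := measurableSet_le measurable_const hm.norm.measurable
  have hS : MeasurableSet S := measurableSet_le measurable_const hm.measurable.nnnorm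
  refine ⟨S, hS, (hW'.meas_ge_lt_top hp hp' (Real.toNNReal_pos.2 (half_pos hε)).ne').ne,
    (ε / 2 + M).toNNReal, _, (hm.indicator hT).aestronglyMeasurable, hM, ?_⟩
  filter_upwards [hVW, hW.1.ae_eq_mk] with x hx hWx
  rw [hWx] at hx
  rw [← ofReal_norm (V x)]
  by_cases hxT : x ∈ T
  · rw [indicator_of_mem hxT, ← ofReal_norm (hW.1.mk W x), add_right_comm,
      ← ENNReal.ofReal_add hε.le (norm_nonneg _)]
    exact (ENNReal.ofReal_le_ofReal (by linarith)).trans le_self_add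
  rw [indicator_of_notMem hxT, enorm_zero, add_zero]
  have hxM : ‖hW.1.mk W x‖ < M := not_le.1 hxT
  by_cases hxS : x ∈ S
  · rw [indicator_of_mem hxS]
    exact (ENNReal.ofReal_le_ofReal (by linarith)).trans le_add_self
  · have hxε : ‖hW.1.mk W x‖ < ε / 2 := by
      simpa only [S, mem_ofPred_eq, not_le, Real.lt_toNNReal_iff_coe_lt, coe_nnnorm] using hxS
    exact (ENNReal.ofReal_le_ofReal (by linarith)).trans le_self_add

theorem lintegral_enorm_mul_enorm_sq_le {F : Type*} [NormedAddCommGroup F] {q : ℝ≥0∞}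
    [ENNReal.HolderConjugate p q] {u : α → F} (hW : AEStronglyMeasurable W ν)
    (hu : AEStronglyMeasurable u ν) :
    ∫⁻ x, ‖W x‖ₑ * ‖u x‖ₑ ^ 2 ∂ν ≤ eLpNorm W p ν * eLpNorm u (q * 2) ν ^ 2 := by
  have hsq := eLpNorm_norm_rpow u (p := q) (μ := ν) two_pos
  simp only [Real.rpow_two, ENNReal.ofReal_ofNat, ENNReal.rpow_two] at hsq
  rw [← hsq]
  refine le_trans (le_of_eq ?_) (eLpNorm_smul_le_mul_eLpNorm (r := 1) (hu.norm.pow 2) hW)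
  rw [eLpNorm_one_eq_lintegral_enorm]
  refine lintegral_congr fun x => ?_
  rw [Pi.smul_apply', Pi.pow_apply, smul_eq_mul, enorm_mul, enorm_pow, enorm_norm]

theorem lintegral_enorm_mul_enorm_sq_le_of_ae_le {F : Type*} [NormedAddCommGroup F] {u : α → F}
    (hu : AEStronglyMeasurable u ν) {S : Set α} (hS : MeasurableSet S) {a b : ℝ≥0∞}
    (hVW : ∀ᵐ x ∂ν, ‖V x‖ₑ ≤ a + S.indicator (fun _ => b) x + ‖W x‖ₑ) :
    ∫⁻ x, ‖V x‖ₑ * ‖u x‖ₑ ^ 2 ∂ν ≤ a * eLpNorm u 2 ν ^ 2 +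
      b * eLpNorm u 2 (ν.restrict S) ^ 2 + ∫⁻ x, ‖W x‖ₑ * ‖u x‖ₑ ^ 2 ∂ν := by
  have hu₂ := hu.enorm.pow_const 2
  have hmul : ∀ᵐ x ∂ν, ‖V x‖ₑ * ‖u x‖ₑ ^ 2 ≤ a * ‖u x‖ₑ ^ 2 +
      S.indicator (fun x => b * ‖u x‖ₑ ^ 2) x + ‖W x‖ₑ * ‖u x‖ₑ ^ 2 := by
    filter_upwards [hVW] with x hx
    rw [indicator_mul_left S (fun _ => b) fun x => ‖u x‖ₑ ^ 2, ← add_mul, ← add_mul]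
    gcongr
  refine (lintegral_mono_ae hmul).trans_eq ?_
  rw [lintegral_add_left' (by fun_prop (disch := assumption)),
    lintegral_add_left' (hu₂.const_mul a), lintegral_indicator hS,
    lintegral_const_mul'' a hu₂, lintegral_const_mul'' b hu₂.restrict, ← eLpNorm_two_sq,
    ← eLpNorm_two_sq]

theorem MemLpAddEps.exists_lintegral_mul_enorm_sq_le (hV : MemLpAddEps V p ν) {q : ℝ≥0∞}
    [ENNReal.HolderConjugate p q] (hp : p ≠ ∞) {ε : ℝ} (hε : 0 < ε) :
    ∃ S, ν S ≠ ∞ ∧ ∃ M : ℝ≥0, ∀ u : α → ℂ, AEStronglyMeasurable u ν →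
      ∫⁻ x, ‖V x‖ₑ * ‖u x‖ₑ ^ 2 ∂ν ≤
        ENNReal.ofReal ε * (eLpNorm u 2 ν ^ 2 + eLpNorm u (q * 2) ν ^ 2) +
          M * eLpNorm u 2 (ν.restrict S) ^ 2 := by
  obtain ⟨S, hSm, hS, M, W, hWm, hW, hVW⟩ :=
    hV.exists_enorm_le (ENNReal.HolderConjugate.ne_zero p q) hp hε
  refine ⟨S, hS, M, fun u hu => (lintegral_enorm_mul_enorm_sq_le_of_ae_le hu hSm hVW).trans ?_⟩
  rw [mul_add, add_right_comm]
  gcongr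
  exact (lintegral_enorm_mul_enorm_sq_le hWm hu).trans (by gcongr)

end MemLpAddEps

section PotentialForm

theorem abs_norm_add_sq_sub_norm_sq_le {F : Type*} [SeminormedAddCommGroup F] (a b : F) {δ : ℝ}
    (hδ : 0 < δ) : |‖a + b‖ ^ 2 - ‖a‖ ^ 2| ≤ δ * ‖a‖ ^ 2 + (1 + δ⁻¹) * ‖b‖ ^ 2 := by
  have hdiff : |‖a + b‖ - ‖a‖| ≤ ‖b‖ := by
    simpa only [add_sub_cancel_left] using abs_norm_sub_norm_le (a + b) a
  calc |‖a + b‖ ^ 2 - ‖a‖ ^ 2|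
      = (‖a + b‖ + ‖a‖) * |‖a + b‖ - ‖a‖| := by
        rw [sq_sub_sq, abs_mul, abs_of_nonneg (by positivity)]
    _ ≤ (‖a‖ + ‖b‖ + ‖a‖) * ‖b‖ := by gcongr; exact norm_add_le a b
    _ = δ * ‖a‖ ^ 2 + (1 + δ⁻¹) * ‖b‖ ^ 2 - δ * (‖a‖ - δ⁻¹ * ‖b‖) ^ 2 := by field_simp; ring
    _ ≤ δ * ‖a‖ ^ 2 + (1 + δ⁻¹) * ‖b‖ ^ 2 := by
        linarith [mul_nonneg hδ.le (sq_nonneg (‖a‖ - δ⁻¹ * ‖b‖))]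

/-- The quadratic form of the potential `V`, transported to `L²` by the Bessel potential. -/
def potForm (V : E3 → ℝ) (f : L2) : ℝ := ∫ x, V x * ‖bessel f x‖ ^ 2

variable {V : E3 → ℝ}

theorem MemLpAddEps.exists_lintegral_mul_bessel_le (hV : MemLpAddEps V (3 / 2) volume) {ε : ℝ}
    (hε : 0 < ε) : ∃ S, volume S ≠ ∞ ∧ ∃ M : ℝ≥0, ∀ f : L2,
      ∫⁻ x, ‖V x‖ₑ * ‖bessel f x‖ₑ ^ 2 ≤
        ENNReal.ofReal ε * ‖f‖ₑ ^ 2 + M * eLpNorm (bessel f) 2 (volume.restrict S) ^ 2 := by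
  obtain ⟨C, hC⟩ := exists_eLpNorm_bessel_le (E := E3) (p' := 6) (by simp)
    (by rw [finrank_euclideanSpace_fin]; norm_num)
  have hpq : ENNReal.HolderConjugate (3 / 2) 3 := by
    rw [ENNReal.holderConjugate_iff, ENNReal.inv_div (by simp) (by simp), div_eq_mul_inv]
    nth_rw 2 [← one_mul (3 : ℝ≥0∞)⁻¹]
    rw [← add_mul, two_add_one_eq_three]
    exact ENNReal.mul_inv_cancel (by simp) (by simp)
  have hbessel (f : L2) :
      eLpNorm (bessel f) 2 volume ^ 2 + eLpNorm (bessel f) (3 * 2) volume ^ 2 ≤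
        ENNReal.ofReal (1 + C ^ 2) * ‖f‖ₑ ^ 2 := by
    rw [← Lp.enorm_def, ENNReal.ofReal_add zero_le_one (by positivity), add_mul, ENNReal.ofReal_one,
      one_mul, ENNReal.ofReal_pow C.coe_nonneg, ENNReal.ofReal_coe_nnreal, ← mul_pow]
    gcongr
    · simpa only [← ofReal_norm] using ENNReal.ofReal_le_ofReal (norm_bessel_le f)
    · simpa only [ENNReal.coe_ofNat, show (3 : ℝ≥0∞) * 2 = 6 by norm_num] using hC f
  have hδ : 0 < ε / (1 + C ^ 2) := by positivity
  obtain ⟨S, hS, M, hM⟩ :=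
    hV.exists_lintegral_mul_enorm_sq_le (q := 3) (by simp [ENNReal.div_eq_top]) hδ
  refine ⟨S, hS, M, fun f => (hM _ (Lp.aestronglyMeasurable _)).trans ?_⟩
  refine add_le_add_left ((mul_le_mul_right (hbessel f) _).trans_eq ?_) _
  rw [← mul_assoc, ← ENNReal.ofReal_mul hδ.le, div_mul_cancel₀ _ (by positivity)]

theorem MemLpAddEps.lintegral_mul_bessel_ne_top (hV : MemLpAddEps V (3 / 2) volume) (f : L2) :
    ∫⁻ x, ‖V x‖ₑ * ‖bessel f x‖ₑ ^ 2 ≠ ∞ := by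
  obtain ⟨S, -, M, hM⟩ := hV.exists_lintegral_mul_bessel_le one_pos
  have hS := ((Lp.memLp (bessel f)).restrict S).eLpNorm_ne_top
  refine ((hM f).trans_lt ?_).ne
  finiteness

theorem MemLpAddEps.integrable_mul_bessel (hV : MemLpAddEps V (3 / 2) volume) (f : L2) :
    Integrable fun x => V x * ‖bessel f x‖ ^ 2 := by
  refine ⟨hV.1.mul (integrable_norm_sq _).aestronglyMeasurable, ?_⟩
  simpa only [HasFiniteIntegral, enorm_mul, enorm_pow, enorm_norm] using
    (hV.lintegral_mul_bessel_ne_top f).lt_top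

theorem enorm_potForm_le (V : E3 → ℝ) (f : L2) :
    ‖potForm V f‖ₑ ≤ ∫⁻ x, ‖V x‖ₑ * ‖bessel f x‖ₑ ^ 2 := by
  refine (enorm_integral_le_lintegral_enorm _).trans_eq (lintegral_congr fun x => ?_)
  rw [enorm_mul, enorm_pow, enorm_norm]

theorem MemLpAddEps.exists_abs_potForm_le (hV : MemLpAddEps V (3 / 2) volume) {ε : ℝ}
    (hε : 0 < ε) : ∃ M : ℝ, ∀ f : L2, |potForm V f| ≤ ε * ‖f‖ ^ 2 + M * ‖bessel f‖ ^ 2 := by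
  obtain ⟨S, -, M, hM⟩ := hV.exists_lintegral_mul_bessel_le hε
  refine ⟨M, fun f => ?_⟩
  rw [← ENNReal.ofReal_le_ofReal_iff (by positivity), ENNReal.ofReal_add (by positivity)
    (by positivity), ENNReal.ofReal_mul hε.le, ENNReal.ofReal_mul M.coe_nonneg,
    ENNReal.ofReal_pow (norm_nonneg _), ENNReal.ofReal_pow (norm_nonneg _), ofReal_norm,
    ofReal_norm, ENNReal.ofReal_coe_nnreal, ← Real.enorm_eq_ofReal_abs]
  refine (enorm_potForm_le V f).trans ((hM f).trans ?_)
  rw [Lp.enorm_def (bessel f)]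
  gcongr
  exact Measure.restrict_le_self

theorem MemLpAddEps.tendsto_lintegral_mul_bessel (hV : MemLpAddEps V (3 / 2) volume) {f : ℕ → L2}
    (hf : WeakTendsto f 0) :
    Tendsto (fun k => ∫⁻ x, ‖V x‖ₑ * ‖bessel (f k) x‖ₑ ^ 2) atTop (𝓝 0) := by
  obtain ⟨B, hB⟩ := hf.exists_norm_le
  refine ENNReal.tendsto_nhds_zero.2 fun ε hε => ?_
  obtain ⟨δ, hδ, hδε⟩ := ENNReal.exists_nnreal_pos_mul_lt
    (ENNReal.pow_ne_top (n := 2) (ENNReal.ofReal_ne_top (r := B))) (ENNReal.half_pos hε.ne').ne'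
  obtain ⟨S, hS, M, hM⟩ := hV.exists_lintegral_mul_bessel_le (NNReal.coe_pos.2 hδ)
  have hloc := ENNReal.Tendsto.const_mul (a := (M : ℝ≥0∞))
    (ENNReal.Tendsto.pow (hf.tendsto_eLpNorm_restrict_bessel hS) (n := 2))
    (Or.inr ENNReal.coe_ne_top)
  rw [zero_pow two_ne_zero, mul_zero] at hloc
  filter_upwards [ENNReal.tendsto_nhds_zero.1 hloc _ (ENNReal.half_pos hε.ne')] with k hk
  refine (hM _).trans ((add_le_add (le_trans ?_ hδε.le) hk).trans_eq (ENNReal.add_halves ε))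
  rw [ENNReal.ofReal_coe_nnreal, ← ofReal_norm]
  gcongr
  exact hB k

theorem MemLpAddEps.enorm_potForm_add_sub_le (hV : MemLpAddEps V (3 / 2) volume) (f g : L2) {δ : ℝ}
    (hδ : 0 < δ) : ‖potForm V (f + g) - potForm V f‖ₑ ≤
      ENNReal.ofReal δ * (∫⁻ x, ‖V x‖ₑ * ‖bessel f x‖ₑ ^ 2) +
        ENNReal.ofReal (1 + δ⁻¹) * ∫⁻ x, ‖V x‖ₑ * ‖bessel g x‖ₑ ^ 2 := by
  have hm (u : L2) : AEMeasurable fun x => ‖V x‖ₑ * ‖bessel u x‖ₑ ^ 2 :=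
    hV.1.enorm.mul ((Lp.aestronglyMeasurable _).enorm.pow_const 2)
  rw [potForm, potForm, ← integral_sub (hV.integrable_mul_bessel _) (hV.integrable_mul_bessel _),
    ← lintegral_const_mul'' _ (hm f), ← lintegral_const_mul'' _ (hm g),
    ← lintegral_add_left' ((hm f).const_mul _)]
  refine (enorm_integral_le_lintegral_enorm _).trans (lintegral_mono_ae ?_)
  filter_upwards [Lp.coeFn_add (bessel f) (bessel g)] with x hx
  rw [← map_add, Pi.add_apply] at hx
  have hsq := ENNReal.ofReal_le_ofReal
    (abs_norm_add_sq_sub_norm_sq_le (bessel f x) (bessel g x) hδ)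
  rw [ENNReal.ofReal_add (by positivity) (by positivity), ENNReal.ofReal_mul hδ.le,
    ENNReal.ofReal_mul (by positivity), ENNReal.ofReal_pow (norm_nonneg _),
    ENNReal.ofReal_pow (norm_nonneg _), ofReal_norm, ofReal_norm, ← Real.enorm_eq_ofReal_abs] at hsq
  rw [hx, ← mul_sub, enorm_mul]
  exact (mul_le_mul_right hsq _).trans_eq (by ring)

theorem MemLpAddEps.tendsto_potForm (hV : MemLpAddEps V (3 / 2) volume) {f : ℕ → L2} {a : L2}
    (hf : WeakTendsto f a) : Tendsto (fun k => potForm V (f k)) atTop (𝓝 (potForm V a)) := by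
  refine tendsto_iff_edist_tendsto_0.2 (ENNReal.tendsto_nhds_zero.2 fun ε hε => ?_)
  obtain ⟨δ, hδ, hδε⟩ := ENNReal.exists_nnreal_pos_mul_lt
    (hV.lintegral_mul_bessel_ne_top a) (ENNReal.half_pos hε.ne').ne'
  rw [← ENNReal.ofReal_coe_nnreal] at hδε
  have hrest := ENNReal.Tendsto.const_mul (a := ENNReal.ofReal (1 + (δ : ℝ)⁻¹))
    (hV.tendsto_lintegral_mul_bessel hf.sub_const) (Or.inr ENNReal.ofReal_ne_top)
  rw [mul_zero] at hrest
  filter_upwards [ENNReal.tendsto_nhds_zero.1 hrest _ (ENNReal.half_pos hε.ne')] with k hk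
  rw [edist_eq_enorm_sub, ← add_sub_cancel a (f k)]
  rw [← add_sub_cancel a (f k)] at hk
  refine (hV.enorm_potForm_add_sub_le a (f k - a) (NNReal.coe_pos.2 hδ)).trans
    ((add_le_add hδε.le ?_).trans_eq (ENNReal.add_halves ε))
  simpa only [add_sub_cancel] using hk

end PotentialForm

/-! ### Coulomb and exchange-correlation potentials -/

section IntegralTranslates

variable {G : Type*} [AddGroup G] [MeasurableSpace G] [MeasurableAdd₂ G] [MeasurableNeg G]
  {μ ν : Measure G} [SFinite μ] [μ.IsAddRightInvariant] [IsFiniteMeasure ν]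
  {F : Type*} [NormedAddCommGroup F] [NormedSpace ℝ F]

theorem lintegral_lintegral_sub (f : G → ℝ≥0∞) (hf : Measurable f) :
    ∫⁻ x, ∫⁻ y, f (x - y) ∂ν ∂μ = ν univ * ∫⁻ x, f x ∂μ := by
  rw [lintegral_lintegral_swap (f := fun x y => f (x - y)) (hf.comp measurable_sub).aemeasurable]
  simp_rw [lintegral_sub_right_eq_self f, lintegral_const, mul_comm]

theorem memLp_integral_comp_sub {W : G → F} {p : ℝ≥0∞} (hWm : StronglyMeasurable W)
    (hW : MemLp W p μ) (hp : 1 ≤ p) (hp' : p ≠ ∞) :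
    MemLp (fun x => ∫ y, W (x - y) ∂ν) p μ := by
  lift p to ℝ≥0 using hp'
  have hp₀ : p ≠ 0 := (zero_lt_one.trans_le (ENNReal.one_le_coe_iff.1 hp)).ne'
  have hWm₂ : StronglyMeasurable (Function.uncurry fun x y => W (x - y)) :=
    hWm.comp_measurable measurable_sub
  refine ⟨hWm₂.integral_prod_right.aestronglyMeasurable, ?_⟩
  rw [← ENNReal.rpow_lt_top_iff_of_pos (NNReal.coe_pos.2 (pos_iff_ne_zero.2 hp₀)),
    eLpNorm_nnreal_pow_eq_lintegral hp₀]
  set c := ν univ ^ (1 / (1 : ℝ≥0∞).toReal - 1 / (p : ℝ≥0∞).toReal)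
  have hjensen (x : G) : ‖∫ y, W (x - y) ∂ν‖ₑ ^ (p : ℝ) ≤
      c ^ (p : ℝ) * ∫⁻ y, ‖W (x - y)‖ₑ ^ (p : ℝ) ∂ν := by
    rw [← eLpNorm_nnreal_pow_eq_lintegral hp₀, ← ENNReal.mul_rpow_of_nonneg _ _ p.coe_nonneg,
      mul_comm]
    gcongr
    refine (enorm_integral_le_lintegral_enorm _).trans ?_
    rw [← eLpNorm_one_eq_lintegral_enorm]
    exact eLpNorm_le_eLpNorm_mul_rpow_measure_univ hp
      (hWm₂.comp_measurable measurable_prodMk_left).aestronglyMeasurable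
  have hm : Measurable fun x => ‖W x‖ₑ ^ (p : ℝ) := hWm.enorm.pow_const _
  have hc : c ^ (p : ℝ) ≠ ∞ := ENNReal.rpow_ne_top_of_nonneg p.coe_nonneg
    (ENNReal.rpow_ne_top_of_nonneg (sub_nonneg.2
      (one_div_le_one_div_of_le one_pos (ENNReal.toReal_mono ENNReal.coe_ne_top hp)))
    (measure_ne_top ν _))
  refine (lintegral_mono hjensen).trans_lt ?_
  rw [lintegral_const_mul' _ _ hc, lintegral_lintegral_sub _ hm,
    ← eLpNorm_nnreal_pow_eq_lintegral hp₀]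
  exact ENNReal.mul_lt_top hc.lt_top (ENNReal.mul_lt_top (measure_lt_top ν _)
    (ENNReal.rpow_lt_top_of_nonneg p.coe_nonneg hW.eLpNorm_ne_top))

end IntegralTranslates

section Coulomb

theorem memLp_indicator_ball_inv_norm {E : Type*} [NormedAddCommGroup E] [NormedSpace ℝ E]
    [FiniteDimensional ℝ E] [MeasurableSpace E] [BorelSpace E] (μ : Measure E)
    [μ.IsAddHaarMeasure] {p : ℝ≥0∞} (hp : p < Module.finrank ℝ E) (R : ℝ) :
    MemLp ((Metric.ball (0 : E) R).indicator fun z => 1 / ‖z‖) p μ := by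
  have hm : AEStronglyMeasurable (fun z : E => 1 / ‖z‖) μ :=
    (Measurable.stronglyMeasurable (by fun_prop)).aestronglyMeasurable
  lift p to ℝ≥0 using (hp.trans (ENNReal.natCast_lt_top _)).ne
  obtain rfl | hp₀ := eq_or_ne p 0
  · exact memLp_zero_iff_aestronglyMeasurable.2 (hm.indicator measurableSet_ball)
  have hpE : (p : ℝ) < Module.finrank ℝ E := by exact_mod_cast hp
  rw [memLp_indicator_iff_restrict measurableSet_ball,
    ← integrable_norm_rpow_iff hm.restrict (by exact_mod_cast hp₀) ENNReal.coe_ne_top]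
  refine integrableOn_ball_of_norm_le_rpow (C := 1) (α := p) ?_ hpE
    (Eventually.of_forall fun z => le_of_eq ?_) ?_
  · have : (0 : ℝ) < Module.finrank ℝ E := p.coe_nonneg.trans_lt hpE
    exact_mod_cast this
  · rw [Real.norm_of_nonneg (by positivity), Real.norm_of_nonneg (by positivity), one_mul,
      ENNReal.coe_toReal, one_div, Real.inv_rpow (norm_nonneg z), Real.rpow_neg (norm_nonneg z)]
  · exact (hm.norm.aemeasurable.pow_const _).aestronglyMeasurable

theorem one_div_norm_le_add_indicator {E : Type*} [SeminormedAddCommGroup E] {δ : ℝ} (hδ : 0 < δ)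
    (z : E) : 1 / ‖z‖ ≤ δ + (Metric.ball (0 : E) δ⁻¹).indicator (fun z => 1 / ‖z‖) z := by
  by_cases hz : z ∈ Metric.ball 0 δ⁻¹
  · rw [indicator_of_mem hz]
    exact le_add_of_nonneg_left hδ.le
  · rw [indicator_of_notMem hz, add_zero]
    rw [mem_ball_zero_iff, not_lt] at hz
    exact (one_div_le_one_div_of_le (inv_pos.2 hδ) hz).trans_eq (by rw [one_div, inv_inv])

/-- The Coulomb potential of the measure `ν`. -/
def coulombPot (ν : Measure E3) (x : E3) : ℝ := ∫ y, 1 / ‖x - y‖ ∂ν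

theorem abs_coulombPot_le (ν : Measure E3) [IsFiniteMeasure ν] {δ : ℝ} (hδ : 0 < δ) (x : E3) :
    |coulombPot ν x| ≤ ν.real univ * δ +
      |∫ y, (Metric.ball (0 : E3) δ⁻¹).indicator (fun z => 1 / ‖z‖) (x - y) ∂ν| := by
  set W := (Metric.ball (0 : E3) δ⁻¹).indicator fun z => 1 / ‖z‖
  have hWm : Measurable W := Measurable.indicator (by fun_prop) measurableSet_ball
  rw [coulombPot]
  by_cases hi : Integrable (fun y => 1 / ‖x - y‖) ν
  · have hWi : Integrable (fun y => W (x - y)) ν :=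
      hi.mono (hWm.comp (measurable_const_sub x)).aestronglyMeasurable
        (Eventually.of_forall fun y => norm_indicator_le_norm_self _ _)
    rw [abs_of_nonneg (integral_nonneg fun y => by positivity)]
    calc ∫ y, 1 / ‖x - y‖ ∂ν
        ≤ ∫ y, δ + W (x - y) ∂ν :=
          integral_mono hi ((integrable_const δ).add hWi) fun y =>
            one_div_norm_le_add_indicator hδ (x - y)
      _ = ν.real univ * δ + ∫ y, W (x - y) ∂ν := by
          rw [integral_add (integrable_const δ) hWi, integral_const, smul_eq_mul]
      _ ≤ ν.real univ * δ + |∫ y, W (x - y) ∂ν| := by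
          gcongr
          exact le_abs_self _
  · rw [integral_undef hi, abs_zero]
    positivity

theorem memLpAddEps_coulombPot (ν : Measure E3) [IsFiniteMeasure ν] :
    MemLpAddEps (coulombPot ν) (3 / 2) volume := by
  have hk : StronglyMeasurable fun z : E3 => 1 / ‖z‖ := Measurable.stronglyMeasurable (by fun_prop)
  have hk₂ : StronglyMeasurable (Function.uncurry fun x y : E3 => 1 / ‖x - y‖) :=
    hk.comp_measurable measurable_sub
  refine ⟨hk₂.integral_prod_right.aestronglyMeasurable, fun ε hε => ?_⟩
  set δ := ε / (ν.real univ + 1)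
  have hδ : 0 < δ := by positivity
  have hδε : ν.real univ * δ ≤ ε := by
    rw [mul_div_assoc', div_le_iff₀ (by positivity)]
    linarith
  have hp : (1 : ℝ≥0∞) ≤ 3 / 2 := by
    rw [ENNReal.le_div_iff_mul_le (by simp) (by simp)]
    norm_num
  have hW : MemLp ((Metric.ball (0 : E3) δ⁻¹).indicator fun z => 1 / ‖z‖) (3 / 2) volume :=
    memLp_indicator_ball_inv_norm _ (by
      rw [finrank_euclideanSpace_fin, ENNReal.div_lt_iff (by simp) (by simp)]
      norm_num) _
  exact ⟨_, memLp_integral_comp_sub (ν := ν) (hk.indicator measurableSet_ball) hW hp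
      (by simp [ENNReal.div_eq_top]),
    Eventually.of_forall fun x => (abs_coulombPot_le ν hδ x).trans (by gcongr; exact le_rfl)⟩

end Coulomb

section ExchangeCorrelation

variable {g : ℝ → ℝ} {c : ℝ} {r : ℝ≥0}

theorem exists_abs_le_add_mul_rpow (hg : ContinuousWithinAt g (Ici 0) 0) (h0 : g 0 = 0)
    (hgrowth : ∀ t, 0 ≤ t → |g t| ≤ c * (1 + t ^ (r : ℝ))) {ε : ℝ} (hε : 0 < ε) :
    ∃ C, ∀ t, 0 ≤ t → |g t| ≤ ε + C * t ^ (r : ℝ) := by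
  have hc : 0 ≤ c := by
    have := (abs_nonneg _).trans (hgrowth 1 zero_le_one)
    rw [Real.one_rpow] at this
    linarith
  obtain ⟨δ, hδ, hδε⟩ := Metric.continuousWithinAt_iff.1 hg ε hε
  refine ⟨c * (1 + (δ ^ (r : ℝ))⁻¹), fun t ht => ?_⟩
  rcases lt_or_ge t δ with htδ | htδ
  · have hgt := @hδε t ht (by rwa [Real.dist_0_eq_abs, abs_of_nonneg ht])
    rw [h0, Real.dist_0_eq_abs] at hgt
    exact hgt.le.trans (le_add_of_nonneg_right (by positivity))
  · have hone : 1 ≤ (δ ^ (r : ℝ))⁻¹ * t ^ (r : ℝ) := by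
      rw [← inv_mul_cancel₀ (Real.rpow_pos_of_pos hδ r).ne']
      gcongr
    calc |g t| ≤ c * (1 + t ^ (r : ℝ)) := hgrowth t ht
      _ ≤ c * ((δ ^ (r : ℝ))⁻¹ * t ^ (r : ℝ) + t ^ (r : ℝ)) := by gcongr
      _ = c * (1 + (δ ^ (r : ℝ))⁻¹) * t ^ (r : ℝ) := by ring
      _ ≤ ε + c * (1 + (δ ^ (r : ℝ))⁻¹) * t ^ (r : ℝ) := le_add_of_nonneg_left hε.le

theorem memLpAddEps_comp_of_growth {α : Type*} [MeasurableSpace α] {ν : Measure α}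
    (hg : ContinuousOn g (Ici 0)) (h0 : g 0 = 0)
    (hgrowth : ∀ t, 0 ≤ t → |g t| ≤ c * (1 + t ^ (r : ℝ))) {ρ : α → ℝ} (hρ : Integrable ρ ν)
    (hρ₀ : ∀ x, 0 ≤ ρ x) : MemLpAddEps (fun x => g (ρ x)) (r : ℝ≥0∞)⁻¹ ν := by
  have hcont : Continuous fun t : ℝ => g (max t 0) :=
    hg.comp_continuous (by fun_prop) fun t => le_max_right t 0
  refine ⟨?_, fun ε hε => ?_⟩
  · simpa only [max_eq_left (hρ₀ _)] using hcont.comp_aestronglyMeasurable hρ.1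
  · obtain ⟨C, hC⟩ := exists_abs_le_add_mul_rpow (hg 0 self_mem_Ici) h0 hgrowth hε
    have hρr := ((memLp_one_iff_integrable.2 hρ).norm_rpow_div r).const_mul C
    rw [one_div] at hρr
    refine ⟨_, hρr, Eventually.of_forall fun x => (hC _ (hρ₀ x)).trans ?_⟩
    rw [Real.norm_of_nonneg (hρ₀ x), ENNReal.coe_toReal]
    exact add_le_add_right (Real.le_norm_self _) ε

end ExchangeCorrelation

section TotalPotential

variable {n : ℕ}

theorem integrable_density (Φ : Fin n → L2) : Integrable (density Φ) :=
  (integrable_finsetSum _ fun k _ => integrable_norm_sq (Φ k)).const_mul 2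

theorem density_nonneg (Φ : Fin n → L2) (x : E3) : 0 ≤ density Φ x := by
  unfold density
  positivity

theorem integral_density {Φ : Fin n → L2} (hΦ : Orthonormal ℂ Φ) : ∫ x, density Φ x = 2 * n := by
  unfold density
  rw [integral_const_mul, integral_finsetSum _ fun k _ => integrable_norm_sq (Φ k)]
  simp only [← norm_sq_eq_integral, hΦ.1, one_pow, Finset.sum_const, Finset.card_univ,
    Fintype.card_fin, nsmul_eq_mul, mul_one]

theorem vHartree_eq_coulombPot {ρ : E3 → ℝ} (hρ : Integrable ρ) (hρ₀ : ∀ x, 0 ≤ ρ x) :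
    vHartree ρ = coulombPot (volume.withDensity fun x => ENNReal.ofReal (ρ x)) := by
  ext x
  rw [vHartree, coulombPot, integral_withDensity_eq_integral_toReal_smul₀
    hρ.aemeasurable.ennreal_ofReal (Eventually.of_forall fun _ => ENNReal.ofReal_lt_top)]
  refine integral_congr_ae (Eventually.of_forall fun y => ?_)
  simp only [ENNReal.toReal_ofReal (hρ₀ y), smul_eq_mul, mul_one_div]

/-- The total potential `v_ext + v_H + v_xc(ρ)`. -/
def totalPot (exc : ℝ → ℝ) (μ : Measure E3) (ρ : E3 → ℝ) (x : E3) : ℝ :=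
  vext μ x + vHartree ρ x + vxc exc (ρ x)

theorem memLpAddEps_totalPot {exc : ℝ → ℝ} (hexc : ContDiffOn ℝ 1 exc (Ici 0))
    (h0 : vxc exc 0 = 0) {c : ℝ}
    (hgrowth : ∀ ρ, 0 ≤ ρ → |vxc exc ρ| ≤ c * (1 + ρ ^ (2 / 3 : ℝ))) (μ : Measure E3)
    [IsFiniteMeasure μ] {ρ : E3 → ℝ} (hρ : Integrable ρ) (hρ₀ : ∀ x, 0 ≤ ρ x) :
    MemLpAddEps (totalPot exc μ ρ) (3 / 2) volume := by
  have hHartree : MemLpAddEps (vHartree ρ) (3 / 2) volume := by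
    have := isFiniteMeasure_withDensity_ofReal hρ.2
    rw [vHartree_eq_coulombPot hρ hρ₀]
    exact memLpAddEps_coulombPot _
  have hxc : MemLpAddEps (fun x => vxc exc (ρ x)) (3 / 2) volume := by
    have hcont : ContinuousOn (vxc exc) (Ici 0) :=
      hexc.continuousOn_derivWithin (uniqueDiffOn_Ici 0) le_rfl
    have h := memLpAddEps_comp_of_growth (r := 2 / 3) hcont h0
      (by simpa only [NNReal.coe_div, NNReal.coe_ofNat] using hgrowth) hρ hρ₀
    rwa [ENNReal.coe_div three_ne_zero, ENNReal.coe_ofNat, ENNReal.coe_ofNat,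
      ENNReal.inv_div (by simp) (by simp)] at h
  exact ((memLpAddEps_coulombPot μ).neg.add hHartree).add hxc

theorem AdmissibleXC.exists_abs_vxc_le {exc : ℝ → ℝ} (hexc : AdmissibleXC exc) :
    ∃ c : ℝ, ∀ ρ, 0 ≤ ρ → |vxc exc ρ| ≤ c * (1 + ρ ^ (2 / 3 : ℝ)) := by
  obtain ⟨p, hp, hp', c, hc, hgrowth⟩ := hexc.growth
  refine ⟨2 * c, fun ρ hρ => (hgrowth ρ hρ).trans ?_⟩
  have hpow : ρ ^ (p - 1) ≤ 1 + ρ ^ (2 / 3 : ℝ) := by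
    rcases le_total ρ 1 with hρ1 | hρ1
    · exact (Real.rpow_le_one hρ hρ1 (by linarith)).trans
        (le_add_of_nonneg_right (by positivity))
    · exact (Real.rpow_le_rpow_of_exponent_le hρ1 (by linarith)).trans
        (le_add_of_nonneg_left zero_le_one)
  rw [mul_comm 2, mul_assoc]
  gcongr
  linarith [Real.rpow_nonneg hρ (2 / 3)]

end TotalPotential

/-! ### The energy functional, its maximisers and its minimisers -/

section Energy

/-- The quadratic form `½ ∫ |∇χ|² + ∫ V |χ|²` of the Schrödinger operator `-½ Δ + V`. -/
def energy (V : E3 → ℝ) (χ : L2) : ℝ :=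
  1 / 2 * (∫ x, ∑ i, ‖weakPartial i χ x‖ ^ 2) + ∫ x, V x * ‖χ x‖ ^ 2

theorem excitationEnergy_eq_energy (exc : ℝ → ℝ) (μ : Measure E3) (ρ : E3 → ℝ) :
    excitationEnergy exc μ ρ = energy (totalPot exc μ ρ) := rfl

theorem energy_bessel (V : E3 → ℝ) (f : L2) :
    energy V (bessel f) = 2 * π ^ 2 * (‖f‖ ^ 2 - ‖bessel f‖ ^ 2) + potForm V f := by
  rw [energy, integral_sum_weakPartial_bessel, potForm]
  ring

theorem potForm_smul (V : E3 → ℝ) (c : ℂ) (f : L2) :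
    potForm V (c • f) = ‖c‖ ^ 2 * potForm V f := by
  rw [potForm, potForm, map_smul, ← integral_const_mul]
  refine integral_congr_ae ?_
  filter_upwards [Lp.coeFn_smul c (bessel f)] with x hx
  rw [hx, Pi.smul_apply, norm_smul]
  ring

theorem energy_smul (V : E3 → ℝ) (c : ℂ) {χ : L2} (hχ : χ ∈ H1) :
    energy V (c • χ) = ‖c‖ ^ 2 * energy V χ := by
  obtain ⟨f, rfl⟩ := mem_H1_iff.1 hχ
  rw [← map_smul, energy_bessel, energy_bessel, potForm_smul, map_smul, norm_smul, norm_smul]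
  ring

theorem energy_zero (V : E3 → ℝ) : energy V 0 = 0 := by
  simpa using energy_smul V 0 H1.zero_mem

variable {V : E3 → ℝ}

theorem MemLpAddEps.continuous_potForm (hV : MemLpAddEps V (3 / 2) volume) :
    Continuous (potForm V) :=
  SeqContinuous.continuous fun _ _ hf => hV.tendsto_potForm (WeakTendsto.of_tendsto hf)

theorem MemLpAddEps.continuous_energy_subtype (hV : MemLpAddEps V (3 / 2) volume)
    {K : Submodule ℂ L2} [FiniteDimensional ℂ K] (hK : K ≤ H1) :
    Continuous fun χ : K => energy V χ := by
  have hrange (χ : K) : (χ : L2) ∈ bessel.toLinearMap.range := mem_H1_iff.1 (hK χ.2)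
  let T : K →ₗ[ℂ] L2 :=
    (LinearEquiv.ofInjective bessel.toLinearMap bessel_injective).symm.toLinearMap.comp
      (K.subtype.codRestrict _ hrange)
  have hT (χ : K) : bessel (T χ) = χ :=
    LinearEquiv.ofInjective_symm_apply (h := bessel_injective) bessel.toLinearMap
      ⟨(χ : L2), hrange χ⟩
  have hTc : Continuous T := T.continuous_of_finiteDimensional
  have hpot := hV.continuous_potForm.comp hTc
  have henergy (χ : K) :
      energy V χ = 2 * π ^ 2 * (‖T χ‖ ^ 2 - ‖(χ : L2)‖ ^ 2) + potForm V (T χ) := by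
    rw [← hT χ, energy_bessel, hT]
  simp_rw [henergy]
  fun_prop

theorem MemLpAddEps.exists_isMaxOn_energy (hV : MemLpAddEps V (3 / 2) volume)
    {K : Submodule ℂ L2} [FiniteDimensional ℂ K] [Nontrivial K] (hK : K ≤ H1) :
    ∃ φ ∈ {χ | χ ∈ K ∧ ‖χ‖ = 1}, IsMaxOn (energy V) {χ | χ ∈ K ∧ ‖χ‖ = 1} φ := by
  have := FiniteDimensional.proper ℂ K
  obtain ⟨ψ, hψ⟩ := exists_ne (0 : K)
  obtain ⟨φ, hφ, hmax⟩ := (isCompact_sphere (0 : K) 1).exists_isMaxOn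
    ⟨_, mem_sphere_zero_iff_norm.2 (norm_smul_inv_norm (𝕜 := ℂ) hψ)⟩
    (hV.continuous_energy_subtype hK).continuousOn
  refine ⟨φ, ⟨φ.2, mem_sphere_zero_iff_norm.1 hφ⟩, fun χ hχ => ?_⟩
  exact hmax (a := ⟨χ, hχ.1⟩) (mem_sphere_zero_iff_norm.2 hχ.2)

theorem MemLpAddEps.exists_norm_sq_le_energy_add (hV : MemLpAddEps V (3 / 2) volume) :
    ∃ C : ℝ, ∀ f, ‖f‖ ^ 2 ≤ energy V (bessel f) + C * ‖bessel f‖ ^ 2 := by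
  obtain ⟨M, hM⟩ := hV.exists_abs_potForm_le one_pos
  refine ⟨2 * π ^ 2 + M, fun f => ?_⟩
  have hpot := (abs_le.1 (hM f)).1
  have hπ : 1 ≤ π ^ 2 := one_le_pow₀ (by linarith [Real.pi_gt_three])
  rw [energy_bessel]
  nlinarith [sq_nonneg ‖f‖]

theorem MemLpAddEps.energy_bessel_le_of_tendsto (hV : MemLpAddEps V (3 / 2) volume) {f : ℕ → L2}
    {a : L2} (hf : WeakTendsto f a) {m : ℝ}
    (hm : Tendsto (fun k => energy V (bessel (f k))) atTop (𝓝 m)) : energy V (bessel a) ≤ m := by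
  have hkin : Tendsto (fun k => ‖f k‖ ^ 2 - ‖bessel (f k)‖ ^ 2) atTop
      (𝓝 ((2 * π ^ 2)⁻¹ * (m - potForm V a))) := by
    refine ((hm.sub (hV.tendsto_potForm hf)).const_mul (2 * π ^ 2)⁻¹).congr fun k => ?_
    rw [energy_bessel]
    field_simp
    ring
  have hlsc := hf.norm_sq_sub_norm_sq_map_le norm_bessel_le hkin
  rw [← div_eq_inv_mul, le_div_iff₀' (by positivity)] at hlsc
  rw [energy_bessel]
  linarith

theorem MemLpAddEps.bddBelow_energy_image (hV : MemLpAddEps V (3 / 2) volume) {S : Set L2}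
    (hS : ∀ χ ∈ S, χ ∈ H1 ∧ ‖χ‖ = 1) : BddBelow (energy V '' S) := by
  obtain ⟨C, hC⟩ := hV.exists_norm_sq_le_energy_add
  refine ⟨-C, ?_⟩
  rintro _ ⟨χ, hχ, rfl⟩
  obtain ⟨hχ₁, hχ₂⟩ := hS χ hχ
  obtain ⟨f, rfl⟩ := mem_H1_iff.1 hχ₁
  have hf := hC f
  rw [hχ₂] at hf
  linarith [sq_nonneg ‖f‖]

theorem MemLpAddEps.exists_weakTendsto_minimizing (hV : MemLpAddEps V (3 / 2) volume) {S : Set L2}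
    (hS : ∀ χ ∈ S, χ ∈ H1 ∧ ‖χ‖ = 1) (hne : S.Nonempty) :
    ∃ (f : ℕ → L2) (a : L2), (∀ k, bessel (f k) ∈ S) ∧ WeakTendsto f a ∧
      Tendsto (fun k => energy V (bessel (f k))) atTop (𝓝 (sInf (energy V '' S))) := by
  obtain ⟨e, hanti, hlim, he⟩ :=
    exists_seq_tendsto_sInf (hne.image (energy V)) (hV.bddBelow_energy_image hS)
  choose χ hχ hχe using he
  choose f hf using fun k => mem_H1_iff.1 (hS _ (hχ k)).1
  obtain ⟨C, hC⟩ := hV.exists_norm_sq_le_energy_add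
  have hbound (k : ℕ) : ‖f k‖ ≤ √(e 0 + C) := by
    refine Real.le_sqrt_of_sq_le ((hC (f k)).trans ?_)
    rw [hf, hχe, (hS _ (hχ k)).2]
    linarith [hanti (Nat.zero_le k)]
  have : Fact ((2 : ℝ≥0∞) ≠ ∞) := ⟨ENNReal.ofNat_ne_top⟩
  obtain ⟨a, φ, hφ, ha⟩ := exists_subseq_weakTendsto hbound
  refine ⟨f ∘ φ, a, fun k => ?_, ha, ?_⟩
  · rw [Function.comp_apply, hf]
    exact hχ _
  · simp only [Function.comp_apply, hf, hχe]
    exact hlim.comp hφ.tendsto_atTop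

variable {n : ℕ} {Φ : Fin n → L2}

theorem inv_norm_smul_mem_lumoSet {χ : L2} (hχ : χ ∈ H1) (horth : ∀ k, inner ℂ (Φ k) χ = 0)
    (hχ₀ : χ ≠ 0) : (‖χ‖⁻¹ : ℂ) • χ ∈ lumoSet Φ :=
  ⟨H1.smul_mem _ hχ, fun k => by rw [inner_smul_right, horth, mul_zero], norm_smul_inv_norm hχ₀⟩

theorem MemLpAddEps.sInf_mul_norm_sq_le_energy (hV : MemLpAddEps V (3 / 2) volume) {χ : L2}
    (hχ : χ ∈ H1) (horth : ∀ k, inner ℂ (Φ k) χ = 0) :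
    sInf (energy V '' lumoSet Φ) * ‖χ‖ ^ 2 ≤ energy V χ := by
  obtain rfl | hχ₀ := eq_or_ne χ 0
  · simp [energy_zero]
  have hle := csInf_le (hV.bddBelow_energy_image fun ψ hψ => ⟨hψ.1, hψ.2.2⟩)
    (mem_image_of_mem (energy V) (inv_norm_smul_mem_lumoSet hχ horth hχ₀))
  rwa [energy_smul V _ hχ, norm_inv, Complex.norm_real, norm_norm, inv_pow, ← div_eq_inv_mul,
    le_div_iff₀ (pow_pos (norm_pos_iff.2 hχ₀) 2)] at hle

/-- The weak limit of a minimizing sequence satisfies `m ‖χ‖² ≤ energy V χ ≤ m` with `m < 0`, so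
that no mass is lost in the limit. -/
theorem MemLpAddEps.exists_isMinOn_energy_lumoSet (hV : MemLpAddEps V (3 / 2) volume)
    (hneg : ∃ χ ∈ H1, (∀ k, inner ℂ (Φ k) χ = 0) ∧ energy V χ < 0) :
    ∃ φ ∈ lumoSet Φ, IsMinOn (energy V) (lumoSet Φ) φ := by
  have hS : ∀ χ ∈ lumoSet Φ, χ ∈ H1 ∧ ‖χ‖ = 1 := fun χ hχ => ⟨hχ.1, hχ.2.2⟩
  obtain ⟨ψ, hψ, hψorth, hψneg⟩ := hneg
  have hψ₀ : ψ ≠ 0 := by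
    rintro rfl
    exact hψneg.ne (energy_zero V)
  have hm : sInf (energy V '' lumoSet Φ) < 0 := neg_of_mul_neg_left
    ((hV.sInf_mul_norm_sq_le_energy hψ hψorth).trans_lt hψneg) (sq_nonneg ‖ψ‖)
  obtain ⟨f, a, hf, ha, hlim⟩ := hV.exists_weakTendsto_minimizing hS
    ⟨_, inv_norm_smul_mem_lumoSet hψ hψorth hψ₀⟩
  have hmin : energy V (bessel a) ≤ sInf (energy V '' lumoSet Φ) :=
    hV.energy_bessel_le_of_tendsto ha hlim
  have hH1 : bessel a ∈ H1 := mem_H1_iff.2 ⟨a, rfl⟩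
  have horth (k : Fin n) : inner ℂ (Φ k) (bessel a) = 0 :=
    (ha.map bessel).inner_eq_zero fun j => (hf j).2.1 k
  have hle : ‖bessel a‖ ≤ 1 := (ha.map bessel).norm_le fun k => (hf k).2.2.le
  have hge : 1 ≤ ‖bessel a‖ ^ 2 := by
    have := (hV.sInf_mul_norm_sq_le_energy hH1 horth).trans hmin
    nlinarith
  have hnorm : ‖bessel a‖ = 1 :=
    le_antisymm hle ((one_le_sq_iff₀ (norm_nonneg _)).1 hge)
  exact ⟨bessel a, ⟨hH1, horth, hnorm⟩, fun χ hχ =>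
    hmin.trans (csInf_le (hV.bddBelow_energy_image hS) (mem_image_of_mem _ hχ))⟩

end Energy

/-! ### Trial functions of negative energy -/

section TestFunctionEnergy

open scoped Function

variable {V W : E3 → ℝ}

theorem toLp_mem_H1 (u : 𝓢(E3, ℂ)) : (u.toLp 2 : L2) ∈ H1 := by
  change MemSobolev 1 2 _
  rw [Lp.toTemperedDistribution_toLp_eq]
  exact u.memSobolev

theorem weakPartial_toLp (i : Fin 3) (u : 𝓢(E3, ℂ)) :
    weakPartial i (u.toLp 2) = (∂_{(EuclideanSpace.single i (1 : ℝ) : E3)} u).toLp 2 :=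
  weakPartial_eq <| by
    rw [IsWeakPartial, Lp.toTemperedDistribution_toLp_eq, Lp.toTemperedDistribution_toLp_eq,
      lineDerivOp_toTemperedDistributionCLM_eq]

theorem integrable_norm_sq_schwartz {E : Type*} [NormedAddCommGroup E] [NormedSpace ℝ E]
    [MeasurableSpace E] [BorelSpace E] {ν : Measure E} [ν.HasTemperateGrowth]
    (u : 𝓢(E, ℂ)) : Integrable (fun x => ‖u x‖ ^ 2) ν :=
  (u.memLp 2 ν).integrable_norm_pow (p := 2) two_ne_zero

theorem MemLpAddEps.integrable_mul_schwartz (hV : MemLpAddEps V (3 / 2) volume) (u : 𝓢(E3, ℂ)) :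
    Integrable fun x => V x * ‖u x‖ ^ 2 := by
  obtain ⟨f, hf⟩ := mem_H1_iff.1 (toLp_mem_H1 u)
  refine (hV.integrable_mul_bessel f).congr ?_
  rw [hf]
  filter_upwards [u.coeFn_toLp 2 volume] with x hx
  rw [hx]

theorem energy_toLp (V : E3 → ℝ) (u : 𝓢(E3, ℂ)) :
    energy V (u.toLp 2) =
      1 / 2 * (∫ x, ∑ i, ‖(∂_{(EuclideanSpace.single i (1 : ℝ) : E3)} u) x‖ ^ 2) +
        ∫ x, V x * ‖u x‖ ^ 2 := by
  unfold energy
  simp only [weakPartial_toLp]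
  refine congrArg₂ (fun a b => 1 / 2 * a + b) (integral_congr_ae ?_) (integral_congr_ae ?_)
  · filter_upwards [ae_all_iff.2 fun i =>
      (∂_{(EuclideanSpace.single i (1 : ℝ) : E3)} u : 𝓢(E3, ℂ)).coeFn_toLp 2 volume]
      with x hx
    simp only [hx]
  · filter_upwards [u.coeFn_toLp 2 volume] with x hx
    rw [hx]

theorem energy_toLp_mono (hV : MemLpAddEps V (3 / 2) volume) (hW : MemLpAddEps W (3 / 2) volume)
    (hVW : ∀ x, V x ≤ W x) (u : 𝓢(E3, ℂ)) : energy V (u.toLp 2) ≤ energy W (u.toLp 2) := by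
  rw [energy_toLp, energy_toLp]
  exact add_le_add_right (integral_mono (hV.integrable_mul_schwartz u)
    (hW.integrable_mul_schwartz u) fun x => mul_le_mul_of_nonneg_right (hVW x) (sq_nonneg _)) _

theorem norm_sq_sum_of_disjoint_support {α ι F : Type*} [Fintype ι] [SeminormedAddCommGroup F]
    {f : ι → α → F} (hf : Pairwise (Disjoint on fun i => Function.support (f i))) (x : α) :
    ‖∑ i, f i x‖ ^ 2 = ∑ i, ‖f i x‖ ^ 2 := by
  by_cases hx : ∃ i, f i x ≠ 0
  · obtain ⟨i, hi⟩ := hx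
    have hj (j : ι) (hj : j ≠ i) : f j x = 0 :=
      Function.notMem_support.1 ((hf hj).notMem_of_mem_right hi)
    rw [Finset.sum_eq_single i (fun j _ => hj j) (by simp),
      Finset.sum_eq_single i (fun j _ hji => by simp [hj j hji]) (by simp)]
  · push Not at hx
    simp [hx]

theorem energy_sum_toLp (hV : MemLpAddEps V (3 / 2) volume) {ι : Type*} [Fintype ι]
    {u : ι → 𝓢(E3, ℂ)} (hu : Pairwise (Disjoint on fun i => tsupport (u i))) :
    energy V (∑ i, (u i).toLp 2) = ∑ i, energy V ((u i).toLp 2) := by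
  have hval (x : E3) : ‖(∑ i, u i) x‖ ^ 2 = ∑ i, ‖u i x‖ ^ 2 := by
    rw [sum_apply]
    exact norm_sq_sum_of_disjoint_support
      (fun i j hij => (hu hij).mono (subset_tsupport _) (subset_tsupport _)) x
  have hderiv (m x : E3) : ‖(∂_{m} (∑ i, u i)) x‖ ^ 2 = ∑ i, ‖(∂_{m} (u i)) x‖ ^ 2 := by
    rw [LineDeriv.lineDerivOp_sum, sum_apply]
    refine norm_sq_sum_of_disjoint_support (fun i j hij => (hu hij).mono ?_ ?_) x <;>
      exact (subset_tsupport _).trans (SchwartzMap.tsupport_lineDerivOp_subset _ _)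
  have hsum : ∑ i, (u i).toLp 2 = (∑ i, u i).toLp 2 :=
    (map_sum (SchwartzMap.toLpCLM ℂ ℂ 2 (volume : Measure E3)) u _).symm
  simp only [hsum, energy_toLp, hval, hderiv, Finset.mul_sum]
  rw [integral_finsetSum _ fun i _ => hV.integrable_mul_schwartz (u i), Finset.sum_add_distrib,
    ← Finset.mul_sum, ← integral_finsetSum _ fun i _ =>
      integrable_finsetSum _ fun j _ => integrable_norm_sq_schwartz _]
  simp only [Finset.sum_comm (s := (Finset.univ : Finset ι))]

theorem energy_sum_smul_toLp (hV : MemLpAddEps V (3 / 2) volume) {ι : Type*} [Fintype ι]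
    (c : ι → ℂ) {u : ι → 𝓢(E3, ℂ)} (hu : Pairwise (Disjoint on fun i => tsupport (u i))) :
    energy V (∑ i, c i • ((u i).toLp 2 : L2)) = ∑ i, ‖c i‖ ^ 2 * energy V ((u i).toLp 2) := by
  have hsmul (i : ι) : ((c i • u i).toLp 2 : L2) = c i • ((u i).toLp 2 : L2) :=
    map_smul (SchwartzMap.toLpCLM ℂ ℂ 2 (volume : Measure E3)) (c i) (u i)
  simp only [← hsmul, ← energy_smul V _ (toLp_mem_H1 _)]
  have hsupp (i : ι) : tsupport (c i • u i) ⊆ tsupport (u i) :=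
    tsupport_smul_subset_right (fun _ => c i) (u i)
  exact energy_sum_toLp hV fun i j hij => (hu hij).mono (hsupp i) (hsupp j)

end TestFunctionEnergy

section HartreePotential

open scoped Convolution

variable {g : E3 → ℝ}

theorem locallyIntegrable_one_div_norm : LocallyIntegrable fun z : E3 => 1 / ‖z‖ :=
  locallyIntegrable_of_norm_le_rpow (C := 1) (α := 1) (by simp) (by simp)
    (Eventually.of_forall fun z => by simp [Real.rpow_neg_one])
    (Measurable.stronglyMeasurable (by fun_prop)).aestronglyMeasurable

theorem vHartree_eq_convolution (g : E3 → ℝ) :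
    vHartree g = g ⋆[ContinuousLinearMap.mul ℝ ℝ, volume] fun z => 1 / ‖z‖ := by
  ext x
  simp only [vHartree, convolution_def, ContinuousLinearMap.mul_apply', mul_one_div]

theorem continuous_vHartree (hg : Continuous g) (hgc : HasCompactSupport g) :
    Continuous (vHartree g) := by
  rw [vHartree_eq_convolution]
  exact hgc.continuous_convolution_left _ hg locallyIntegrable_one_div_norm

theorem integrable_div_norm_sub (hg : Continuous g) (hgc : HasCompactSupport g) (x : E3) :
    Integrable fun y => g y / ‖x - y‖ := by
  have h : Integrable fun y => g y * (1 / ‖x - y‖) :=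
    hgc.convolutionExists_left (ContinuousLinearMap.mul ℝ ℝ) hg locallyIntegrable_one_div_norm x
  simpa only [mul_one_div] using h

theorem exists_integral_norm_div_norm_sub_le (hg : Continuous g) (hgc : HasCompactSupport g) :
    ∃ C, ∀ x, ∫ y, ‖g y / ‖x - y‖‖ ≤ C := by
  obtain ⟨M, hM⟩ := hgc.exists_bound_of_continuous hg
  set W := (Metric.ball (0 : E3) 1⁻¹).indicator fun z => 1 / ‖z‖
  have hW : Integrable W := memLp_one_iff_integrable.1 (memLp_indicator_ball_inv_norm _ (by simp) _)
  have hgi : Integrable g := hg.integrable_of_hasCompactSupport hgc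
  have hW₀ (z : E3) : 0 ≤ W z := indicator_nonneg (fun z _ => by positivity) z
  refine ⟨(∫ y, ‖g y‖) + M * ∫ z, W z, fun x => ?_⟩
  have hWx : Integrable fun y => M * W (x - y) := (hW.comp_sub_left x).const_mul M
  calc ∫ y, ‖g y / ‖x - y‖‖ ≤ ∫ y, ‖g y‖ + M * W (x - y) := by
        refine integral_mono (integrable_div_norm_sub hg hgc x).norm (hgi.norm.add hWx) fun y => ?_
        calc ‖g y / ‖x - y‖‖ = ‖g y‖ * (1 / ‖x - y‖) := by
              rw [norm_div, norm_norm, mul_one_div]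
          _ ≤ ‖g y‖ * (1 + W (x - y)) := by
              gcongr
              exact one_div_norm_le_add_indicator one_pos (x - y)
          _ = ‖g y‖ + ‖g y‖ * W (x - y) := by ring
          _ ≤ ‖g y‖ + M * W (x - y) := by
              gcongr
              exacts [hW₀ _, hM y]
    _ = (∫ y, ‖g y‖) + M * ∫ z, W z := by
        rw [integral_add hgi.norm hWx, integral_const_mul, integral_sub_left_eq_self W volume x]

theorem integral_coulombPot_mul (ν : Measure E3) [IsFiniteMeasure ν] (hg : Continuous g)
    (hgc : HasCompactSupport g) : ∫ x, coulombPot ν x * g x = ∫ y, vHartree g y ∂ν := by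
  obtain ⟨C, hC⟩ := exists_integral_norm_div_norm_sub_le hg hgc
  have hm : StronglyMeasurable (Function.uncurry fun y x : E3 => g x / ‖y - x‖) :=
    Measurable.stronglyMeasurable (by fun_prop)
  have hint : Integrable (Function.uncurry fun y x : E3 => g x / ‖y - x‖) (ν.prod volume) :=
    (integrable_prod_iff hm.aestronglyMeasurable).2
      ⟨Eventually.of_forall (integrable_div_norm_sub hg hgc),
        (integrable_const C).mono' hm.norm.integral_prod_right.aestronglyMeasurable
          (Eventually.of_forall fun y => by
            rw [Real.norm_of_nonneg (integral_nonneg fun _ => norm_nonneg _)]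
            exact hC y)⟩
  simp only [vHartree]
  rw [integral_integral_swap hint]
  refine integral_congr_ae (Eventually.of_forall fun x => ?_)
  simp only [coulombPot, ← integral_mul_const, norm_sub_rev x, one_div_mul_eq_div]

theorem vHartree_zero_pos (hg : Continuous g) (hgc : HasCompactSupport g) (hg₀ : ∀ x, 0 ≤ g x)
    {z : E3} (hz : 0 < g z) : 0 < vHartree g 0 := by
  refine (integral_pos_iff_support_of_nonneg (fun y => ?_)
    (integrable_div_norm_sub hg hgc 0)).2 ?_
  · exact div_nonneg (hg₀ y) (norm_nonneg _)
  · have hopen : IsOpen (Function.support g) := isOpen_ne_fun hg continuous_const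
    refine (hopen.measure_pos volume ⟨z, hz.ne'⟩).trans_le ?_
    rw [← measure_sdiff_null (measure_singleton (0 : E3))]
    refine measure_mono fun y hy => div_ne_zero hy.1 ?_
    rw [zero_sub, norm_neg]
    exact norm_ne_zero_iff.2 hy.2

theorem tendsto_integral_vHartree_smul (ν : Measure E3) [IsFiniteMeasure ν] (hg : Continuous g)
    (hgc : HasCompactSupport g) :
    Tendsto (fun a : ℝ => ∫ y, vHartree g (a • y) ∂ν) (𝓝 0) (𝓝 (ν.real univ * vHartree g 0)) := by
  obtain ⟨C, hC⟩ := exists_integral_norm_div_norm_sub_le hg hgc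
  have hcont := continuous_vHartree hg hgc
  rw [← smul_eq_mul, ← integral_const]
  refine tendsto_integral_filter_of_dominated_convergence (fun _ => C)
    (Eventually.of_forall fun a => (hcont.comp (continuous_const_smul a)).aestronglyMeasurable)
    (Eventually.of_forall fun a => Eventually.of_forall fun y =>
      (norm_integral_le_integral_norm _).trans (hC _))
    (integrable_const C) (Eventually.of_forall fun y => ?_)
  have h : Continuous fun a : ℝ => vHartree g (a • y) := by fun_prop
  simpa only [zero_smul] using h.tendsto 0

theorem vHartree_comp_smul (g : E3 → ℝ) {a : ℝ} (ha : 0 < a) (y : E3) :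
    vHartree (fun x => g (a • x)) y = (a ^ 2)⁻¹ * vHartree g (a • y) := by
  have h (x : E3) : g (a • x) / ‖y - x‖ = a * (g (a • x) / ‖a • y - a • x‖) := by
    rw [← smul_sub, norm_smul, Real.norm_of_nonneg ha.le]
    field_simp
  simp only [vHartree, h]
  rw [integral_const_mul, Measure.integral_comp_smul_of_nonneg volume
    (fun x => g x / ‖a • y - x‖) a (hR := ha.le), finrank_euclideanSpace_fin, smul_eq_mul]
  field_simp

end HartreePotential

section Dilation

variable {E : Type*} [NormedAddCommGroup E] [NormedSpace ℝ E]

/-- The dilation `x ↦ u (eᵗ x)` of a Schwartz function; large negative `t` spreads `u` out. -/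
def dilate (t : ℝ) (u : 𝓢(E, ℂ)) : 𝓢(E, ℂ) :=
  SchwartzMap.compCLMOfContinuousLinearEquiv ℂ
    (ContinuousLinearEquiv.smulLeft (Units.mk0 (Real.exp t) (Real.exp_ne_zero t))) u

theorem lineDerivOp_dilate (t : ℝ) (u : 𝓢(E, ℂ)) (m x : E) :
    (∂_{m} (dilate t u)) x = Real.exp t • (∂_{m} u) (Real.exp t • x) := by
  rw [dilate, SchwartzMap.lineDerivOp_compCLMOfContinuousLinearEquiv]
  change (∂_{Real.exp t • m} u) (Real.exp t • x) = _
  rw [LineDeriv.lineDerivOp_left_smul]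
  rfl

theorem tsupport_dilate (t : ℝ) (u : 𝓢(E, ℂ)) :
    tsupport (dilate t u) = (Real.exp t • ·) ⁻¹' tsupport u :=
  tsupport_comp_eq_preimage u (Homeomorph.smulOfNeZero _ (Real.exp_ne_zero t))

theorem integral_sum_norm_sq_lineDerivOp_dilate (t : ℝ) (u : 𝓢(E3, ℂ)) {ι : Type*} [Fintype ι]
    (m : ι → E3) :
    ∫ x, ∑ i, ‖(∂_{m i} (dilate t u)) x‖ ^ 2 =
      (Real.exp t)⁻¹ * ∫ x, ∑ i, ‖(∂_{m i} u) x‖ ^ 2 := by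
  simp only [lineDerivOp_dilate, norm_smul, Real.norm_of_nonneg (Real.exp_nonneg t), mul_pow,
    ← Finset.mul_sum]
  rw [integral_const_mul, Measure.integral_comp_smul_of_nonneg volume
    (fun x => ∑ i, ‖(∂_{m i} u : 𝓢(E3, ℂ)) x‖ ^ 2) _ (hR := Real.exp_nonneg t),
    finrank_euclideanSpace_fin, smul_eq_mul]
  field_simp

theorem integral_coulombPot_mul_dilate (ν : Measure E3) [IsFiniteMeasure ν] (t : ℝ)
    {u : 𝓢(E3, ℂ)} (hu : HasCompactSupport u) :
    ∫ x, coulombPot ν x * ‖dilate t u x‖ ^ 2 =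
      (Real.exp t ^ 2)⁻¹ * ∫ y, vHartree (fun x => ‖u x‖ ^ 2) (Real.exp t • y) ∂ν := by
  have hsupp : HasCompactSupport (dilate t u) :=
    hu.comp_homeomorph (Homeomorph.smulOfNeZero _ (Real.exp_ne_zero t))
  have hsq : HasCompactSupport fun x => ‖dilate t u x‖ ^ 2 :=
    hsupp.comp_left (g := fun w => ‖w‖ ^ 2) (by simp)
  rw [integral_coulombPot_mul ν (by fun_prop) hsq, ← integral_const_mul]
  exact integral_congr_ae (Eventually.of_forall
    (vHartree_comp_smul (fun x => ‖u x‖ ^ 2) (Real.exp_pos t)))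

theorem memLpAddEps_coulombPot_sub (μ ν : Measure E3) [IsFiniteMeasure μ] [IsFiniteMeasure ν] :
    MemLpAddEps (fun x => coulombPot ν x - coulombPot μ x) (3 / 2) volume := by
  simpa only [sub_eq_add_neg] using (memLpAddEps_coulombPot ν).add (memLpAddEps_coulombPot μ).neg

theorem energy_coulombPot_sub_dilate (μ ν : Measure E3) [IsFiniteMeasure μ] [IsFiniteMeasure ν]
    (t : ℝ) {u : 𝓢(E3, ℂ)} (hu : HasCompactSupport u) :
    energy (fun x => coulombPot ν x - coulombPot μ x) ((dilate t u).toLp 2) =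
      (Real.exp t ^ 2)⁻¹ * (Real.exp t *
        (1 / 2 * ∫ x, ∑ i, ‖(∂_{(EuclideanSpace.single i (1 : ℝ) : E3)} u) x‖ ^ 2) +
        ((∫ y, vHartree (fun x => ‖u x‖ ^ 2) (Real.exp t • y) ∂ν) -
          ∫ y, vHartree (fun x => ‖u x‖ ^ 2) (Real.exp t • y) ∂μ)) := by
  simp only [energy_toLp, integral_sum_norm_sq_lineDerivOp_dilate, sub_mul]
  rw [integral_sub ((memLpAddEps_coulombPot ν).integrable_mul_schwartz _)
    ((memLpAddEps_coulombPot μ).integrable_mul_schwartz _),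
    integral_coulombPot_mul_dilate ν t hu, integral_coulombPot_mul_dilate μ t hu]
  field_simp

/-- Under `u ↦ u (eᵗ ·)` the Coulomb terms scale like `e⁻²ᵗ` and the kinetic term only like `e⁻ᵗ`,
so that for `t → -∞` the sign of the energy is the sign of the net charge. -/
theorem eventually_energy_dilate_neg {V : E3 → ℝ} (hV : MemLpAddEps V (3 / 2) volume)
    {μ ν : Measure E3} [IsFiniteMeasure μ] [IsFiniteMeasure ν]
    (hVle : ∀ x, V x ≤ coulombPot ν x - coulombPot μ x) (hνμ : ν.real univ < μ.real univ)
    {u : 𝓢(E3, ℂ)} (hu : HasCompactSupport u) {z : E3} (hz : u z ≠ 0) :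
    ∀ᶠ t in atBot, energy V ((dilate t u).toLp 2) < 0 := by
  set g : E3 → ℝ := fun x => ‖u x‖ ^ 2
  have hg : Continuous g := by fun_prop
  have hgc : HasCompactSupport g := hu.comp_left (g := fun w => ‖w‖ ^ 2) (by simp)
  set K := 1 / 2 * ∫ x, ∑ i, ‖(∂_{(EuclideanSpace.single i (1 : ℝ) : E3)} u) x‖ ^ 2
  have hlim : Tendsto (fun a : ℝ => a * K +
      ((∫ y, vHartree g (a • y) ∂ν) - ∫ y, vHartree g (a • y) ∂μ)) (𝓝 0)
      (𝓝 (0 * K + (ν.real univ * vHartree g 0 - μ.real univ * vHartree g 0))) :=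
    (tendsto_id.mul_const K).add ((tendsto_integral_vHartree_smul ν hg hgc).sub
      (tendsto_integral_vHartree_smul μ hg hgc))
  have hneg : 0 * K + (ν.real univ * vHartree g 0 - μ.real univ * vHartree g 0) < 0 := by
    rw [zero_mul, zero_add, ← sub_mul]
    exact mul_neg_of_neg_of_pos (sub_neg.2 hνμ)
      (vHartree_zero_pos hg hgc (fun x => sq_nonneg _) (z := z) (by positivity))
  filter_upwards [Real.tendsto_exp_atBot.eventually (hlim.eventually_lt_const hneg)] with t ht
  refine (energy_toLp_mono hV (memLpAddEps_coulombPot_sub μ ν) hVle _).trans_lt ?_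
  rw [energy_coulombPot_sub_dilate μ ν t hu]
  exact mul_neg_of_pos_of_neg (by positivity) ht

end Dilation

section TrialSpace

open scoped Function

theorem exists_schwartzMap_pairwise_disjoint (E : Type*) [NormedAddCommGroup E] [NormedSpace ℝ E]
    [FiniteDimensional ℝ E] [HasContDiffBump E] [Nontrivial E] :
    ∃ u : ℕ → 𝓢(E, ℂ), (∀ i, HasCompactSupport (u i)) ∧ (∀ i, ∃ z, u i z ≠ 0) ∧
      Pairwise (Disjoint on fun i => tsupport (u i)) := by
  obtain ⟨e, he⟩ := exists_norm_eq E zero_le_one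
  let bump (i : ℕ) : ContDiffBump ((i : ℝ) • e) := ⟨1 / 4, 1 / 3, by norm_num, by norm_num⟩
  let f (i : ℕ) (x : E) : ℂ := (bump i x : ℂ)
  have hf (i : ℕ) : HasCompactSupport (f i) :=
    (bump i).hasCompactSupport.comp_left Complex.ofReal_zero
  have hsupp (i : ℕ) : tsupport (f i) ⊆ Metric.closedBall ((i : ℝ) • e) (1 / 3) :=
    (tsupport_comp_subset Complex.ofReal_zero _).trans (bump i).tsupport_eq.subset
  refine ⟨fun i => (hf i).toSchwartzMap (Complex.ofRealCLM.contDiff.comp (bump i).contDiff), hf,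
    fun i => ⟨(i : ℝ) • e, ?_⟩, fun i j hij => ?_⟩
  · change ((bump i ((i : ℝ) • e) : ℝ) : ℂ) ≠ 0
    rw [(bump i).one_of_mem_closedBall (Metric.mem_closedBall_self (bump i).rIn_pos.le)]
    exact one_ne_zero
  · refine (Metric.closedBall_disjoint_closedBall ?_).mono (hsupp i) (hsupp j)
    rw [dist_eq_norm, ← sub_smul, norm_smul, he, mul_one, ← dist_eq_norm, Nat.dist_cast_real]
    exact lt_of_lt_of_le (by norm_num) (Nat.pairwise_one_le_dist hij)

theorem exists_ne_zero_inner_sum_eq_zero {H : Type*} [NormedAddCommGroup H] [InnerProductSpace ℂ H]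
    {ι κ : Type*} [Fintype ι] [Fintype κ] (hcard : Fintype.card κ < Fintype.card ι) (Φ : κ → H)
    (v : ι → H) : ∃ c : ι → ℂ, c ≠ 0 ∧ ∀ k, inner ℂ (Φ k) (∑ i, c i • v i) = 0 := by
  let T : (ι → ℂ) →ₗ[ℂ] κ → ℂ :=
    LinearMap.pi fun k => (innerSL ℂ (Φ k)).toLinearMap ∘ₗ Fintype.linearCombination ℂ v
  obtain ⟨c, hc, hc₀⟩ := (Submodule.ne_bot_iff _).1 <|
    LinearMap.ker_ne_bot_of_finrank_lt (f := T) (by simpa using hcard)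
  exact ⟨c, hc₀, fun k => congrFun (LinearMap.mem_ker.1 hc) k⟩

theorem exists_energy_neg {V : E3 → ℝ} (hV : MemLpAddEps V (3 / 2) volume) {μ ν : Measure E3}
    [IsFiniteMeasure μ] [IsFiniteMeasure ν] (hVle : ∀ x, V x ≤ coulombPot ν x - coulombPot μ x)
    (hνμ : ν.real univ < μ.real univ) {n : ℕ} (Φ : Fin n → L2) :
    ∃ χ ∈ H1, (∀ k, inner ℂ (Φ k) χ = 0) ∧ energy V χ < 0 := by
  obtain ⟨u, hu, hu₀, hdisj⟩ := exists_schwartzMap_pairwise_disjoint E3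
  choose z hz using hu₀
  obtain ⟨t, ht⟩ := (eventually_all.2 fun i : Fin (n + 1) =>
    eventually_energy_dilate_neg hV hVle hνμ (hu i) (hz i)).exists
  obtain ⟨c, hc, horth⟩ := exists_ne_zero_inner_sum_eq_zero (by simp) Φ
    fun i : Fin (n + 1) => ((dilate t (u i)).toLp 2 : L2)
  have hdisj_dilate : Pairwise (Disjoint on fun i : Fin (n + 1) => tsupport (dilate t (u i))) :=
    fun i j hij => by
      simp only [Function.onFun, tsupport_dilate]
      exact (hdisj (Fin.val_ne_of_ne hij)).preimage _
  refine ⟨_, Submodule.sum_mem _ fun i _ => Submodule.smul_mem _ _ (toLp_mem_H1 _), horth, ?_⟩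
  rw [energy_sum_smul_toLp hV c hdisj_dilate]
  obtain ⟨i, hi⟩ := Function.ne_iff.1 hc
  exact Finset.sum_neg' (fun j _ => mul_nonpos_of_nonneg_of_nonpos (sq_nonneg _) (ht j).le)
    ⟨i, Finset.mem_univ i, mul_neg_of_pos_of_neg (pow_pos (norm_pos_iff.2 hi) 2) (ht i)⟩

end TrialSpace

section Orbitals

variable {n : ℕ} {Φ : Fin n → L2}

theorem exists_isMaxOn_energy_homoSet {V : E3 → ℝ} (hV : MemLpAddEps V (3 / 2) volume)
    (hn : 1 ≤ n) (hΦ : Φ ∈ orbitalSet n) : ∃ φ ∈ homoSet Φ, IsMaxOn (energy V) (homoSet Φ) φ := by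
  have hfin : FiniteDimensional ℂ (Submodule.span ℂ (range Φ)) :=
    FiniteDimensional.span_of_finite ℂ (finite_range Φ)
  have hnontrivial : Nontrivial (Submodule.span ℂ (range Φ)) :=
    ⟨⟨⟨Φ ⟨0, hn⟩, Submodule.subset_span (mem_range_self _)⟩, 0,
      Subtype.coe_ne_coe.1 (hΦ.2.ne_zero _)⟩⟩
  exact hV.exists_isMaxOn_energy (Submodule.span_le.2 (range_subset_iff.2 hΦ.1))

/-- The measure with density `ρ = 2 ∑ₖ |φₖ|²`: the charge distribution of the electrons. -/
def electronMeasure (Φ : Fin n → L2) : Measure E3 :=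
  volume.withDensity fun x => ENNReal.ofReal (density Φ x)

instance : IsFiniteMeasure (electronMeasure Φ) :=
  isFiniteMeasure_withDensity_ofReal (integrable_density Φ).2

theorem electronMeasure_real_univ (hΦ : Orthonormal ℂ Φ) :
    (electronMeasure Φ).real univ = 2 * n := by
  rw [measureReal_def, electronMeasure, withDensity_apply _ MeasurableSet.univ,
    Measure.restrict_univ, ← integral_eq_lintegral_of_nonneg_ae
      (Eventually.of_forall (density_nonneg Φ)) (integrable_density Φ).1, integral_density hΦ]

theorem totalPot_density_le {exc : ℝ → ℝ} (hneg : ∀ ρ, 0 ≤ ρ → vxc exc ρ ≤ 0) (μ : Measure E3)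
    (Φ : Fin n → L2) (x : E3) :
    totalPot exc μ (density Φ) x ≤ coulombPot (electronMeasure Φ) x - coulombPot μ x := by
  have hxc := hneg (density Φ x) (density_nonneg Φ x)
  rw [totalPot, vHartree_eq_coulombPot (integrable_density Φ) (density_nonneg Φ)]
  change -coulombPot μ x + coulombPot (electronMeasure Φ) x + _ ≤ _
  linarith

end Orbitals

end KohnSham

end

theorem theorem3p1_general {exc : ℝ → ℝ} (hexc : ContDiffOn ℝ 1 exc (Ici 0))
    (h0 : KohnSham.vxc exc 0 = 0) (hneg : ∀ ρ, 0 ≤ ρ → KohnSham.vxc exc ρ ≤ 0) {c : ℝ}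
    (hgrowth : ∀ ρ, 0 ≤ ρ → |KohnSham.vxc exc ρ| ≤ c * (1 + ρ ^ (2 / 3 : ℝ)))
    (μ : Measure KohnSham.E3) [IsFiniteMeasure μ] {n : ℕ} (hn : 1 ≤ n) {Φ : Fin n → KohnSham.L2}
    (hΦ : Φ ∈ KohnSham.orbitalSet n) :
    (∃ φH ∈ KohnSham.homoSet Φ,
      IsMaxOn (KohnSham.excitationEnergy exc μ (KohnSham.density Φ)) (KohnSham.homoSet Φ) φH) ∧
    ((2 * n : ℝ) < μ.real univ →
      ∃ φL ∈ KohnSham.lumoSet Φ,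
        IsMinOn (KohnSham.excitationEnergy exc μ (KohnSham.density Φ))
          (KohnSham.lumoSet Φ) φL) := by
  have hV := KohnSham.memLpAddEps_totalPot hexc h0 hgrowth μ (KohnSham.integrable_density Φ)
    (KohnSham.density_nonneg Φ)
  rw [KohnSham.excitationEnergy_eq_energy]
  refine ⟨KohnSham.exists_isMaxOn_energy_homoSet hV hn hΦ, fun hcharge => ?_⟩
  rw [← KohnSham.electronMeasure_real_univ hΦ.2] at hcharge
  exact hV.exists_isMinOn_energy_lumoSet
    (KohnSham.exists_energy_neg hV (KohnSham.totalPot_density_le hneg μ Φ) hcharge Φ)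

theorem theorem3p1 (exc : ℝ → ℝ) (hexc : KohnSham.AdmissibleXC exc)
    (Ω : Set KohnSham.E3) (hΩ : IsCompact Ω) (Z : ℝ) (hZ : 0 < Z)
    (n : ℕ) (hn : 1 ≤ n)
    (μ : MeasureTheory.Measure KohnSham.E3) (hμ : μ ∈ KohnSham.Anuc Ω Z)
    (Φ : Fin n → KohnSham.L2) (hΦ : Φ ∈ KohnSham.orbitalSet n) :
    (∃ φH ∈ KohnSham.homoSet Φ,
      IsMaxOn (KohnSham.excitationEnergy exc μ (KohnSham.density Φ)) (KohnSham.homoSet Φ) φH) ∧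
    ((2 * n : ℝ) < Z → KohnSham.ExpDecay Φ →
      ∃ φL ∈ KohnSham.lumoSet Φ,
        IsMinOn (KohnSham.excitationEnergy exc μ (KohnSham.density Φ))
          (KohnSham.lumoSet Φ) φL) := by
  have : IsFiniteMeasure μ := ⟨hμ.2.trans_lt ENNReal.ofReal_lt_top⟩
  obtain ⟨c, hc⟩ := hexc.exists_abs_vxc_le
  rw [← ENNReal.toReal_ofReal hZ.le, ← hμ.2, ← measureReal_def]
  exact (theorem3p1_general hexc.contDiffOn hexc.vxc_zero hexc.vxc_nonpos hc μ hn hΦ).imp_right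
    fun h hcharge _ => h hcharge
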